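/- Let $(W,S)$ be an irreducible right-angled Coxeter system with finite generating set $S$, $|S|\ge 3$; that is, $W=\langle S \mid (st)^{m_{st}}=e\rangle$ with $m_{ss}=1$, $m_{st}=m_{ts}\in\{2,\infty\}$ for $s\ne t$, and $S$ is not a disjoint union of two non-empty subsets that commute with each other. Let $|\cdot|$ be the word length with respect to $S$, let $\mathbf q=(q_s)_{s\in S}\in(0,1]^S$, $r\in[1,\infty)$ and $p_s=(q_s-1)/\sqrt{q_s}$. For $s\in S$ let $T_s$ act on the complex space $\ell^r(W)$ from the left and from the right by $$T_s\delta_w=\begin{cases}\delta_{sw}&|sw|>|w|,\\ \delta_{sw}+p_s\delta_w&|sw|<|w|,\end{cases}\qquad \delta_wT_s=\begin{cases}\delta_{ws}&|ws|>|w|,\\ \delta_{ws}+p_s\delta_w&|ws|<|w|,\end{cases}$$ and put $T_w=T_{s_1}\cdots T_{s_n}$ for a reduced expression $w=s_1\cdots s_n$. A vector $\xi\in\ell^r(W)$ is called Hecke central if $T_w\xi=\xi T_w$ for all $w\in W$, and a non-zero vector $\eta\in\ell^r(W)$ is called a Hecke eigenvector if $T_s\eta\in\mathbb C\eta$ for all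 $s\in S$. For $\varepsilon\in\{-1,1\}^S$ write $q_{w,\varepsilon}=\prod_{i=1}^n\varepsilon_{s_i}q_{s_i}^{\varepsilon_{s_i}}$ for a reduced expression $w=s_1\cdots s_n$, and let $\eta_\varepsilon=\sum_{w\in W}q_{w,\varepsilon}^{1/2}\delta_w$, where $x^{1/2}:=\operatorname{sgn}(x)|x|^{1/2}$. Then every Hecke central vector in $\ell^r(W)$ is a (finite) complex linear combination of $\delta_e$ and of Hecke eigenvectors of the form $\eta_\varepsilon$ that belong to $\ell^r(W)$. -/

import Mathlib

open scoped ENNReal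

noncomputable section

namespace RACoxeter

variable {S : Type*} {W : Type*} [Group W] {M : CoxeterMatrix S}

/-- All off-diagonal entries of the Coxeter matrix are `2` or `∞` (`∞` is encoded as `0`). -/
def IsRightAngled (M : CoxeterMatrix S) : Prop :=
  ∀ s t : S, s ≠ t → M s t = 2 ∨ M s t = 0

/-- There is no partition of the generators into two non-empty, mutually commuting subsets. -/
def IsIrreducible (M : CoxeterMatrix S) : Prop :=
  ¬ ∃ A : Set S, A.Nonempty ∧ Aᶜ.Nonempty ∧ ∀ s ∈ A, ∀ t ∈ Aᶜ, M s t = 2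

/-- The space `ℓ^r(W)` of complex-valued functions on `W`. -/
abbrev Ell (W : Type*) (r : ℝ≥0∞) : Type _ := lp (fun _ : W => ℂ) r

theorem memℓp_comp_injective {α : Type*} {r : ℝ≥0∞} {x : α → ℂ} (hx : Memℓp x r)
    {f : α → α} (hf : Function.Injective f) : Memℓp (fun a => x (f a)) r := by
  rcases r.trichotomy with (rfl | rfl | hr)
  · exact memℓp_zero ((memℓp_zero_iff.1 hx).preimage hf.injOn)
  · refine memℓp_infty ((memℓp_infty_iff.1 hx).mono ?_)
    rintro _ ⟨a, rfl⟩
    exact ⟨f a, rfl⟩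
  · exact (memℓp_gen_iff hr).2 (((memℓp_gen_iff hr).1 hx).comp_injective hf)

theorem memℓp_ite {α : Type*} {r : ℝ≥0∞} {x : α → ℂ} (hx : Memℓp x r) (P : α → Prop)
    [DecidablePred P] (c : ℝ) :
    Memℓp (fun a => if P a then (c : ℂ) * x a else 0) r := by
  refine (hx.const_mul (c : ℂ)).mono' (fun a => ?_)
  by_cases h : P a <;> simp [h, mul_nonneg]

/-- The constant `p_s = (q_s - 1) / √q_s`. -/
def pCoeff (q : S → ℝ) (s : S) : ℝ := (q s - 1) / √(q s)

/-- The formula for `T_s` acting from the left on functions on `W`. -/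
def heckeLeftFun (cs : CoxeterSystem M W) (q : S → ℝ) (s : S) (x : W → ℂ) (w : W) : ℂ :=
  x (cs.simple s * w) + if cs.length (cs.simple s * w) < cs.length w then (pCoeff q s : ℂ) * x w else 0

theorem memℓp_heckeLeftFun (cs : CoxeterSystem M W) (q : S → ℝ) {r : ℝ≥0∞} (s : S) {x : W → ℂ}
    (hx : Memℓp x r) : Memℓp (heckeLeftFun cs q s x) r :=
  (memℓp_comp_injective hx (mul_right_injective (cs.simple s))).add 
    (memℓp_ite hx (fun w => cs.length (cs.simple s * w) < cs.length w) (pCoeff q s))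

/-- The operator `T_s` acting from the left on `ℓ^r(W)`.  On basis vectors it is given by
`T_s δ_w = δ_{sw}` if `|sw| > |w|` and `T_s δ_w = δ_{sw} + p_s δ_w` if `|sw| < |w|`,
see `heckeLeft_delta`. -/
def heckeLeft (cs : CoxeterSystem M W) (q : S → ℝ) {r : ℝ≥0∞} (s : S) :
    Ell W r →ₗ[ℂ] Ell W r where
  toFun ξ := ⟨heckeLeftFun cs q s ξ, memℓp_heckeLeftFun cs q s (lp.memℓp ξ)⟩
  map_add' ξ η := by
    refine lp.ext (funext fun w => ?_)
    change heckeLeftFun cs q s (fun v => ξ v + η v) w =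
      heckeLeftFun cs q s ξ w + heckeLeftFun cs q s η w
    unfold heckeLeftFun
    split_ifs <;> ring
  map_smul' c ξ := by
    refine lp.ext (funext fun w => ?_)
    change heckeLeftFun cs q s (fun v => c * ξ v) w = c * heckeLeftFun cs q s ξ w
    unfold heckeLeftFun
    split_ifs <;> ring

theorem heckeLeft_apply (cs : CoxeterSystem M W) (q : S → ℝ) {r : ℝ≥0∞} (s : S) (ξ : Ell W r)
    (w : W) : heckeLeft cs q s ξ w = heckeLeftFun cs q s ξ w := rfl

/-- The formula for `T_s` acting from the right on functions on `W`. -/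
def heckeRightFun (cs : CoxeterSystem M W) (q : S → ℝ) (s : S) (x : W → ℂ) (w : W) : ℂ :=
  x (w * cs.simple s) + if cs.length (w * cs.simple s) < cs.length w then (pCoeff q s : ℂ) * x w else 0

theorem memℓp_heckeRightFun (cs : CoxeterSystem M W) (q : S → ℝ) {r : ℝ≥0∞} (s : S) {x : W → ℂ}
    (hx : Memℓp x r) : Memℓp (heckeRightFun cs q s x) r :=
  (memℓp_comp_injective hx (mul_left_injective (cs.simple s))).add 
    (memℓp_ite hx (fun w => cs.length (w * cs.simple s) < cs.length w) (pCoeff q s))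

/-- The operator `T_s` acting from the right on `ℓ^r(W)`.  On basis vectors it is given by
`δ_w T_s = δ_{ws}` if `|ws| > |w|` and `δ_w T_s = δ_{ws} + p_s δ_w` if `|ws| < |w|`,
see `heckeRight_delta`. -/
def heckeRight (cs : CoxeterSystem M W) (q : S → ℝ) {r : ℝ≥0∞} (s : S) :
    Ell W r →ₗ[ℂ] Ell W r where
  toFun ξ := ⟨heckeRightFun cs q s ξ, memℓp_heckeRightFun cs q s (lp.memℓp ξ)⟩
  map_add' ξ η := by
    refine lp.ext (funext fun w => ?_)
    change heckeRightFun cs q s (fun v => ξ v + η v) w =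
      heckeRightFun cs q s ξ w + heckeRightFun cs q s η w
    unfold heckeRightFun
    split_ifs <;> ring
  map_smul' c ξ := by
    refine lp.ext (funext fun w => ?_)
    change heckeRightFun cs q s (fun v => c * ξ v) w = c * heckeRightFun cs q s ξ w
    unfold heckeRightFun
    split_ifs <;> ring

theorem heckeRight_apply (cs : CoxeterSystem M W) (q : S → ℝ) {r : ℝ≥0∞} (s : S) (ξ : Ell W r)
    (w : W) : heckeRight cs q s ξ w = heckeRightFun cs q s ξ w := rfl

open Classical in
/-- The basis vector `δ_w`. -/
def delta (r : ℝ≥0∞) (w : W) : Ell W r := lp.single r w (1 : ℂ)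

theorem delta_self (r : ℝ≥0∞) (w : W) : delta r w w = 1 := by
  simp [delta]

theorem delta_of_ne (r : ℝ≥0∞) {w v : W} (h : v ≠ w) : delta r w v = 0 := by
  simp [delta, h]

theorem heckeLeft_delta (cs : CoxeterSystem M W) (q : S → ℝ) {r : ℝ≥0∞} (s : S) (w : W) :
    heckeLeft cs q s (delta r w) = delta r (cs.simple s * w) +
      (if cs.length (cs.simple s * w) < cs.length w then (pCoeff q s : ℂ) • delta r w else 0) := by
  refine lp.ext (funext fun v => ?_)
  have h : cs.simple s * v = w ↔ v = cs.simple s * w := by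
    constructor <;> rintro rfl <;> simp
  have h' : delta r w (cs.simple s * v) = delta r (cs.simple s * w) v := by
    by_cases hv : v = cs.simple s * w
    · rw [h.2 hv, ← hv, delta_self, delta_self]
    · rw [delta_of_ne r hv, delta_of_ne r (fun hh => hv (h.1 hh))]
  rw [heckeLeft_apply, heckeLeftFun, lp.coeFn_add, Pi.add_apply, h']
  congr 1
  by_cases hl : cs.length (cs.simple s * w) < cs.length w <;> by_cases hv : v = w
  · subst hv
    rw [if_pos hl, if_pos hl, lp.coeFn_smul, Pi.smul_apply, smul_eq_mul]
  · rw [if_pos hl, lp.coeFn_smul, Pi.smul_apply, delta_of_ne r hv]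
    simp
  · subst hv
    rw [if_neg hl, if_neg hl, lp.coeFn_zero, Pi.zero_apply]
  · rw [if_neg hl, delta_of_ne r hv]
    simp

theorem heckeRight_delta (cs : CoxeterSystem M W) (q : S → ℝ) {r : ℝ≥0∞} (s : S) (w : W) :
    heckeRight cs q s (delta r w) = delta r (w * cs.simple s) +
      (if cs.length (w * cs.simple s) < cs.length w then (pCoeff q s : ℂ) • delta r w else 0) := by
  refine lp.ext (funext fun v => ?_)
  have h : v * cs.simple s = w ↔ v = w * cs.simple s := by
    constructor <;> rintro rfl <;> simp
  have h' : delta r w (v * cs.simple s) = delta r (w * cs.simple s) v := by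
    by_cases hv : v = w * cs.simple s
    · rw [h.2 hv, ← hv, delta_self, delta_self]
    · rw [delta_of_ne r hv, delta_of_ne r (fun hh => hv (h.1 hh))]
  rw [heckeRight_apply, heckeRightFun, lp.coeFn_add, Pi.add_apply, h']
  congr 1
  by_cases hl : cs.length (w * cs.simple s) < cs.length w <;> by_cases hv : v = w
  · subst hv
    rw [if_pos hl, if_pos hl, lp.coeFn_smul, Pi.smul_apply, smul_eq_mul]
  · rw [if_pos hl, lp.coeFn_smul, Pi.smul_apply, delta_of_ne r hv]
    simp
  · subst hv
    rw [if_neg hl, if_neg hl, lp.coeFn_zero, Pi.zero_apply]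
  · rw [if_neg hl, delta_of_ne r hv]
    simp

/-- `T_{s₁} ⋯ T_{sₙ} ξ` for the word `s₁ ⋯ sₙ`; this is `T_w ξ` if the word is a reduced
expression of `w`. -/
def heckeLeftWord (cs : CoxeterSystem M W) (q : S → ℝ) {r : ℝ≥0∞} (ω : List S)
    (ξ : Ell W r) : Ell W r :=
  ω.foldr (fun s ζ => heckeLeft cs q s ζ) ξ

/-- `ξ T_{s₁} ⋯ T_{sₙ}` for the word `s₁ ⋯ sₙ`; this is `ξ T_w` if the word is a reduced
expression of `w`. -/
def heckeRightWord (cs : CoxeterSystem M W) (q : S → ℝ) {r : ℝ≥0∞} (ω : List S)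
    (ξ : Ell W r) : Ell W r :=
  ω.foldl (fun ζ s => heckeRight cs q s ζ) ξ

/-- `ξ` is Hecke central: `T_w ξ = ξ T_w` for all `w ∈ W`, where `T_w` is formed along any reduced
expression of `w`. -/
def IsHeckeCentral (cs : CoxeterSystem M W) (q : S → ℝ) {r : ℝ≥0∞} (ξ : Ell W r) : Prop :=
  ∀ ω : List S, cs.IsReduced ω → heckeLeftWord cs q ω ξ = heckeRightWord cs q ω ξ

/-- `η` is a (left) Hecke eigenvector: it is non-zero and `T_s η ∈ ℂ η` for all `s ∈ S`. -/
def IsHeckeEigenvector (cs : CoxeterSystem M W) (q : S → ℝ) {r : ℝ≥0∞} (η : Ell W r) : Prop :=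
  η ≠ 0 ∧ ∀ s : S, ∃ c : ℂ, heckeLeft cs q s η = c • η

/-- `q_{w,ε} = ∏ᵢ ε_{sᵢ} q_{sᵢ}^{ε_{sᵢ}}` for the word `s₁ ⋯ sₙ`, `w = s₁ ⋯ sₙ`. -/
def wordWeight (q : S → ℝ) (ε : S → ℤˣ) (ω : List S) : ℝ :=
  (ω.map fun s => ((ε s : ℤ) : ℝ) * q s ^ (ε s : ℤ)).prod

/-- The signed square root `sgn(x) |x|^{1/2}`. -/
def signedSqrt (x : ℝ) : ℝ := (SignType.sign x : ℝ) * √|x|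

/-- `η` is the vector `η_ε = ∑_w q_{w,ε}^{1/2} δ_w`, where `q_{w,ε}` is computed along any reduced
expression of `w`. -/
def IsEta (cs : CoxeterSystem M W) (q : S → ℝ) {r : ℝ≥0∞} (ε : S → ℤˣ) (η : Ell W r) : Prop :=
  ∀ ω : List S, cs.IsReduced ω → η (cs.wordProd ω) = (signedSqrt (wordWeight q ε ω) : ℂ)

end RACoxeter

end

/-!
Let `x` be a Hecke central vector. The heart of the proof is that all commutators
`k = T_s T_t - T_t T_s` act on `x` as they act on one and the same multiple `C δ_e` of `δ_e`.
The vector `ζ = x - C δ_e` is again central and annihilated by all `k`, so `k h ζ = k ζ h = 0` for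
all `h` in the Hecke algebra. Hence the `T_s` commute on the cyclic module generated by `ζ`.
Each `T_s` satisfies a quadratic equation with the distinct roots `√q_s` and `-1/√q_s`, so the spectral
projections of the finitely many `T_s` decompose `ζ` into joint eigenvectors inside `ℓ^r(W)`
(`IsCommuting.mem_span`), and a joint eigenvector is a multiple of some `η_ε`
(`apply_wordProd_of_eigenvector`).

Only the decay of `x` at infinity is used to find `C`. Let `s` and `t` not commute.
* The vector `κ = k x` satisfies `T_s κ + κ T_s = p_s κ`, and likewise for `t`. Therefore
  `κ (s w s) = -κ w` if conjugation by `s` makes `w` longer. Then conjugation by `t`, `s`, `t`, …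
  makes it longer and longer, so that `κ w = 0`, because `|κ|` is constant along this sequence. The
  same relation treats the elements with `s` at both ends, and it follows that `κ` lives on the
  elements with `s` at one end and `t` at the other end (`IsCentral.support_leftComm`). If `c` does
  not commute with `t`, then `c` is not a descent of such an element with `κ w ≠ 0`, even if `c`
  commutes with `s` (`IsCentral.not_isLeftDescent_of_leftComm_ne_zero`).
* Let `κ'` be defined in the same way by `k' = T_{s'} T_{t'} - T_{t'} T_{s'}`. As `x` is central,
  `k T_v κ' = κ T_v k'` for all `v`. If `v` is a product along a path in the non-commutation graph
  with suitable ends, all products occurring here are length additive by the previous step, and the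
  identity reads `κ' w = κ (s t · v w t' s' v⁻¹) - κ (s t · v w s' t' v⁻¹)`
  (`IsCentral.leftComm_apply_eq`).
* The path can be chosen such that the conjugates by `v` of any finite set of non-trivial elements
  are arbitrarily long (`exists_long_conj`): from a conjugate of minimal length onwards every step
  would commute with it or shift a letter cyclically, which irreducibility and the presence of a
  third generator exclude. In the limit, only `w = s' t'` and `w = t' s'` survive, and
  `κ' = κ (s t) k'` (`IsCentral.leftComm_apply`).

The facts on descents in right-angled Coxeter groups that this needs come from an action of `W` on
`W × ℤ/2` which counts inversions modulo two. Non-commuting `s` and `t` are never descents on the same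
side, as the alternating words in `s` and `t` are reduced (`dihedralHom_alternating`).
-/

noncomputable section

namespace RACoxeter

/-! ### Descents in right-angled Coxeter groups -/

section Descents

variable {S W : Type*} [Group W] {M : CoxeterMatrix S}

/-- In the right-angled case, a family of involutions extends to a homomorphism as soon as it
respects the commutation relations. -/
theorem IsRightAngled.isLiftable {G : Type*} [Monoid G] (hM : IsRightAngled M) {f : S → G}
    (hinv : ∀ s, f s * f s = 1) (hcomm : ∀ s t, M s t = 2 → f s * f t = f t * f s) :
    M.IsLiftable f := by
  intro s t
  by_cases hst : s = t
  · subst hst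
    simp [hinv]
  · rcases hM s t hst with h | h
    · rw [h, pow_two]
      nth_rw 2 [hcomm s t h]
      rw [mul_assoc, ← mul_assoc (f t), hinv, one_mul, hinv]
    · rw [h, pow_zero]

theorem simple_mul_simple_comm (cs : CoxeterSystem M W) {s t : S} (h : M s t = 2) :
    cs.simple s * cs.simple t = cs.simple t * cs.simple s := by
  have h1 := cs.simple_mul_simple_pow s t
  rw [h, pow_two] at h1
  rw [eq_comm, ← inv_inj]
  simpa [mul_inv_rev, mul_assoc] using eq_inv_of_mul_eq_one_left h1

theorem ne_of_eq_zero {s t : S} (h : M s t = 0) : s ≠ t := by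
  rintro rfl
  simp at h

open Classical in
/-- The involution `(x, e) ↦ (s x s, e + [x = s])` of `W × ℤ/2`. -/
def reflPerm (cs : CoxeterSystem M W) (s : S) : Equiv.Perm (W × ZMod 2) :=
  Function.Involutive.toPerm
    (fun x => (cs.simple s * x.1 * cs.simple s, x.2 + if x.1 = cs.simple s then 1 else 0)) <| by
    rintro ⟨x, e⟩
    have h : cs.simple s * x * cs.simple s = cs.simple s ↔ x = cs.simple s := by
      constructor
      · intro h
        simpa [mul_assoc] using congrArg (fun y => cs.simple s * y * cs.simple s) h
      · rintro rfl
        simp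
    refine Prod.ext (by simp [mul_assoc]) ?_
    simp only [h]
    split_ifs
    · rw [add_assoc, show (1 : ZMod 2) + 1 = 0 from rfl, add_zero]
    · simp

open Classical in
theorem reflPerm_apply (cs : CoxeterSystem M W) (s : S) (x : W) (e : ZMod 2) :
    reflPerm cs s (x, e) =
      (cs.simple s * x * cs.simple s, e + if x = cs.simple s then 1 else 0) := rfl

theorem reflPerm_isLiftable (cs : CoxeterSystem M W) (hM : IsRightAngled M) :
    M.IsLiftable (reflPerm cs) := by
  classical
  refine hM.isLiftable (fun s => ?_) (fun s t h => ?_)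
  · ext1 x
    exact Function.Involutive.toPerm_involutive _ x
  · have hc := simple_mul_simple_comm cs h
    ext1 x
    obtain ⟨x, e⟩ := x
    rw [Equiv.Perm.mul_apply, Equiv.Perm.mul_apply, reflPerm_apply, reflPerm_apply, reflPerm_apply,
      reflPerm_apply]
    have key : ∀ a b : S, cs.simple a * cs.simple b = cs.simple b * cs.simple a →
        (cs.simple a * x * cs.simple a = cs.simple b ↔ x = cs.simple b) := by
      intro a b hab
      constructor
      · intro h
        have := congrArg (fun y => cs.simple a * y * cs.simple a) h
        simpa [mul_assoc, hab] using this
      · rintro rfl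
        simp [hab, mul_assoc]
    refine Prod.ext ?_ ?_
    · have : cs.simple s * (cs.simple t * x * cs.simple t) * cs.simple s =
          (cs.simple s * cs.simple t) * x * (cs.simple t * cs.simple s) := by group
      rw [this, hc, ← hc]
      nth_rw 1 [hc]
      simp only [mul_assoc]
    · simp only [key t s hc.symm, key s t hc]
      ring

/-- The reflection representation of `W` on `W × ℤ/2`. -/
def reflHom (cs : CoxeterSystem M W) (hM : IsRightAngled M) : W →* Equiv.Perm (W × ZMod 2) :=
  cs.lift ⟨reflPerm cs, reflPerm_isLiftable cs hM⟩

/-- The parity of the number of times `x` occurs in the right inversion sequence of a word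
for `w`; it depends on `w` only. -/
def invParity (cs : CoxeterSystem M W) (hM : IsRightAngled M) (w x : W) : ZMod 2 :=
  (reflHom cs hM w (x, 0)).2

variable (cs : CoxeterSystem M W) (hM : IsRightAngled M)

theorem reflHom_simple (s : S) : reflHom cs hM (cs.simple s) = reflPerm cs s :=
  cs.lift_apply_simple _ s

theorem reflHom_apply (w x : W) (e : ZMod 2) :
    reflHom cs hM w (x, e) = (w * x * w⁻¹, e + invParity cs hM w x) := by
  suffices ∀ x, ∃ n, ∀ e, reflHom cs hM w (x, e) = (w * x * w⁻¹, e + n) by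
    obtain ⟨n, hn⟩ := this x
    rw [invParity, hn, hn, zero_add]
  classical
  induction w using cs.simple_induction_left with
  | one => exact fun x => ⟨0, by simp⟩
  | mul_simple_left w s ih =>
    intro x
    obtain ⟨n, hn⟩ := ih x
    refine ⟨n + if w * x * w⁻¹ = cs.simple s then 1 else 0, fun e => ?_⟩
    rw [map_mul, Equiv.Perm.mul_apply, hn, reflHom_simple, reflPerm_apply]
    simp [mul_assoc, add_assoc]

theorem invParity_mul (v w x : W) :
    invParity cs hM (v * w) x = invParity cs hM w x + invParity cs hM v (w * x * w⁻¹) := by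
  have := congrArg Prod.snd (reflHom_apply cs hM (v * w) x 0)
  rw [map_mul, Equiv.Perm.mul_apply, reflHom_apply, reflHom_apply] at this
  simpa using this.symm

theorem invParity_one (x : W) : invParity cs hM 1 x = 0 := by
  simp [invParity]

open Classical in
theorem invParity_simple (s : S) (x : W) :
    invParity cs hM (cs.simple s) x = if x = cs.simple s then 1 else 0 := by
  rw [invParity, reflHom_simple, reflPerm_apply, zero_add]

/-- The exchange condition. -/
theorem exists_eraseIdx_of_invParity_ne_zero (ω : List S) (x : W)
    (h : invParity cs hM (cs.wordProd ω) x ≠ 0) :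
    ∃ i < ω.length, cs.wordProd ω * x = cs.wordProd (ω.eraseIdx i) := by
  classical
  induction ω with
  | nil => simp [invParity_one] at h
  | cons s ω ih =>
    rw [cs.wordProd_cons, invParity_mul, invParity_simple] at h
    by_cases hx : cs.wordProd ω * x * (cs.wordProd ω)⁻¹ = cs.simple s
    · refine ⟨0, by simp, ?_⟩
      rw [cs.wordProd_cons, ← hx]
      have h2 : cs.simple s * cs.wordProd ω = cs.wordProd ω * x := by rw [← hx]; group
      rw [hx, mul_assoc, ← h2]
      simp
    · rw [if_neg hx, add_zero] at h
      obtain ⟨i, hi, he⟩ := ih h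
      refine ⟨i + 1, by simpa using hi, ?_⟩
      rw [cs.wordProd_cons, mul_assoc, he, List.eraseIdx_cons_succ, cs.wordProd_cons]

theorem length_mul_lt_of_invParity_ne_zero {w x : W} (h : invParity cs hM w x ≠ 0) :
    cs.length (w * x) < cs.length w := by
  obtain ⟨ω, hω, rfl⟩ := cs.exists_isReduced w
  obtain ⟨i, hi, he⟩ := exists_eraseIdx_of_invParity_ne_zero cs hM ω x h
  rw [he, hω.eq]
  refine (cs.length_wordProd_le _).trans_lt ?_
  rw [List.length_eraseIdx_of_lt hi]
  omega

theorem isRightDescent_iff_invParity {w : W} {t : S} :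
    cs.IsRightDescent w t ↔ invParity cs hM w (cs.simple t) ≠ 0 := by
  classical
  refine ⟨fun h h0 => ?_, length_mul_lt_of_invParity_ne_zero cs hM⟩
  rw [cs.isRightDescent_iff_not_isRightDescent_mul] at h
  refine h (length_mul_lt_of_invParity_ne_zero cs hM ?_)
  rw [invParity_mul, invParity_simple]
  simp [h0]

include hM

/-- Two generators conjugate in a right-angled Coxeter group are equal. -/
theorem simple_mul_ne_mul_simple {s t : S} (hst : s ≠ t) (w : W) :
    cs.simple s * w ≠ w * cs.simple t := by
  classical
  intro h
  have hl : M.IsLiftable (fun u : S => Multiplicative.ofAdd (if u = s then 1 else 0 : ZMod 2)) := by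
    refine hM.isLiftable (fun u => ?_) (fun u v _ => mul_comm _ _)
    rw [← ofAdd_add]
    split_ifs
    · exact congrArg _ (show (1 : ZMod 2) + 1 = 0 from rfl)
    · simp
  have h2 := congrArg (cs.lift ⟨_, hl⟩) h
  rw [map_mul, map_mul, mul_comm, mul_left_cancel_iff, cs.lift_apply_simple,
    cs.lift_apply_simple] at h2
  simp [hst.symm] at h2

theorem isRightDescent_simple_mul_iff {s t : S} {w : W} (h : cs.simple s * w ≠ w * cs.simple t) :
    cs.IsRightDescent (cs.simple s * w) t ↔ cs.IsRightDescent w t := by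
  classical
  rw [isRightDescent_iff_invParity cs hM, isRightDescent_iff_invParity cs hM, invParity_mul,
    invParity_simple, if_neg, add_zero]
  intro h2
  apply h
  rw [← h2]
  group

theorem isLeftDescent_mul_simple_iff {s t : S} {w : W} (h : cs.simple s * w ≠ w * cs.simple t) :
    cs.IsLeftDescent (w * cs.simple t) s ↔ cs.IsLeftDescent w s := by
  rw [← cs.isRightDescent_inv_iff, ← cs.isRightDescent_inv_iff (w := w), mul_inv_rev,
    cs.inv_simple]
  refine isRightDescent_simple_mul_iff cs hM fun h2 => h ?_
  rw [← inv_inj]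
  simpa using h2.symm

theorem isRightDescent_mul_simple_iff_of_comm {s t : S} (h : M s t = 2) (w : W) :
    cs.IsRightDescent (w * cs.simple s) t ↔ cs.IsRightDescent w t := by
  classical
  have hst : s ≠ t := by
    rintro rfl
    simp at h
  have h1 : cs.simple t ≠ cs.simple s := fun h' =>
    simple_mul_ne_mul_simple cs hM hst 1 (by simpa using h'.symm)
  rw [isRightDescent_iff_invParity cs hM, isRightDescent_iff_invParity cs hM, invParity_mul,
    invParity_simple, if_neg h1, zero_add, simple_mul_simple_comm cs h]
  simp

theorem isLeftDescent_simple_mul_iff_of_comm {s t : S} (h : M s t = 2) (w : W) :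
    cs.IsLeftDescent (cs.simple s * w) t ↔ cs.IsLeftDescent w t := by
  rw [← cs.isRightDescent_inv_iff, ← cs.isRightDescent_inv_iff (w := w), mul_inv_rev,
    cs.inv_simple]
  exact isRightDescent_mul_simple_iff_of_comm cs hM h _

theorem not_isRightDescent_simple_mul {s : S} {w : W} (hr : ¬ cs.IsRightDescent w s)
    (h : cs.simple s * w ≠ w * cs.simple s) : ¬ cs.IsRightDescent (cs.simple s * w) s := by
  rwa [isRightDescent_simple_mul_iff cs hM h]

end Descents

section Infinite

variable {S W : Type*} [Group W] {M : CoxeterMatrix S}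

open Classical in
/-- The action of the generators on `ℤ` in which `s` and `t` are the reflections in `0` and in `2`
and all other generators act trivially. -/
def dihedralPerm (s t : S) (u : S) : Equiv.Perm ℤ :=
  if u = s then Equiv.subLeft 0 else if u = t then Equiv.subLeft 4 else 1

theorem dihedralPerm_isLiftable (hM : IsRightAngled M) {s t : S} (h : M s t = 0) :
    M.IsLiftable (dihedralPerm s t) := by
  refine hM.isLiftable (fun u => ?_) (fun u v huv => ?_)
  · ext x
    simp only [dihedralPerm]
    split_ifs <;> simp
  · have h' : M t s = 0 := by rwa [M.symmetric]
    simp only [dihedralPerm]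
    split_ifs <;> subst_vars <;> simp_all

variable (cs : CoxeterSystem M W) (hM : IsRightAngled M)

/-- The action of `W` on `ℤ` through the infinite dihedral group generated by `s` and `t`. -/
def dihedralHom {s t : S} (h : M s t = 0) : W →* Equiv.Perm ℤ :=
  cs.lift ⟨dihedralPerm s t, dihedralPerm_isLiftable hM h⟩

theorem dihedralHom_simple {s t : S} (h : M s t = 0) (u : S) :
    dihedralHom cs hM h (cs.simple u) = dihedralPerm s t u :=
  cs.lift_apply_simple _ u

theorem abs_dihedralHom_le {s t : S} (h : M s t = 0) (ω : List S) :
    |dihedralHom cs hM h (cs.wordProd ω) 1 - 1| ≤ 2 * ω.length := by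
  induction ω with
  | nil => simp
  | cons u ω ih =>
    rw [cs.wordProd_cons, map_mul, Equiv.Perm.mul_apply, dihedralHom_simple]
    generalize dihedralHom cs hM h (cs.wordProd ω) 1 = p at ih
    rw [abs_le] at ih ⊢
    simp only [dihedralPerm, List.length_cons]
    push_cast
    split_ifs <;> simp <;> omega

open Classical in
theorem dihedralHom_alternating {s t : S} (h : M s t = 0) (ω : List S)
    (hω : ω.IsChain (· ≠ ·)) (hmem : ∀ u ∈ ω, u = s ∨ u = t) :
    dihedralHom cs hM h (cs.wordProd ω) 1 =
      if ω.head? = some s then 1 - 2 * (ω.length : ℤ) else 1 + 2 * (ω.length : ℤ) := by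
  have hst := ne_of_eq_zero h
  induction ω with
  | nil => simp
  | cons u ω ih =>
    have ih := ih hω.tail (fun v hv => hmem v (List.mem_cons_of_mem _ hv))
    rw [cs.wordProd_cons, map_mul, Equiv.Perm.mul_apply, dihedralHom_simple, ih]
    cases ω with
    | nil =>
      rcases hmem u (by simp) with rfl | rfl
      · simp [dihedralPerm]
      · simp [dihedralPerm, hst.symm]
    | cons v ω =>
      have huv : u ≠ v := (List.isChain_cons_cons.1 hω).1
      rcases hmem u (by simp) with rfl | rfl <;> rcases hmem v (by simp) with rfl | rfl
      · exact absurd rfl huv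
      · simp [dihedralPerm, hst.symm]
        ring
      · simp [dihedralPerm, hst.symm]
        ring
      · exact absurd rfl huv

include hM

/-- If `s` and `t` were both right descents of `w`, then `w` could be written with longer and longer
alternating words in `s` and `t` at its right end. -/
theorem exists_alternating_suffix {s t : S} (h : M s t = 0) {w : W} (hs : cs.IsRightDescent w s)
    (ht : cs.IsRightDescent w t) (n : ℕ) :
    ∃ (u : W) (ω : List S), ω.IsChain (· ≠ ·) ∧ (∀ a ∈ ω, a = s ∨ a = t) ∧ ω.length = n ∧
      w = u * cs.wordProd ω ∧ cs.length u + n = cs.length w := by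
  have hst := ne_of_eq_zero h
  induction n with
  | zero => exact ⟨w, [], by simp⟩
  | succ n ih =>
    obtain ⟨u, ω, hω, hmem, hlen, hw, hu⟩ := ih
    -- the letter continuing the alternation
    obtain ⟨b, hb, hbw, hb'⟩ : ∃ b, (b = s ∨ b = t) ∧ cs.IsRightDescent w b ∧
        (ω ++ [b]).IsChain (· ≠ ·) := by
      by_cases hl : ω.getLast? = some s
      · refine ⟨t, Or.inr rfl, ht, List.isChain_append.2 ⟨hω, by simp, ?_⟩⟩
        simp [hl, hst]
      · refine ⟨s, Or.inl rfl, hs, List.isChain_append.2 ⟨hω, by simp, ?_⟩⟩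
        intro x hx y hy hxy
        simp only [List.head?_cons, Option.mem_def, Option.some.injEq] at hy
        subst hy hxy
        exact hl hx
    have hmem' : ∀ a ∈ ω ++ [b], a = s ∨ a = t := by
      intro a ha
      rcases List.mem_append.1 ha with ha | ha
      · exact hmem a ha
      · rwa [List.mem_singleton.1 ha]
    have hprod : cs.wordProd (ω ++ [b]) = cs.wordProd ω * cs.simple b := by
      rw [cs.wordProd_append, cs.wordProd_singleton]
    have h0 : invParity cs hM (cs.wordProd ω) (cs.simple b) = 0 := by
      by_contra hne
      obtain ⟨i, hi, he⟩ := exists_eraseIdx_of_invParity_ne_zero cs hM ω _ hne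
      have h1 := dihedralHom_alternating cs hM h _ hb' hmem'
      have h2 := abs_dihedralHom_le cs hM h (ω.eraseIdx i)
      rw [← he, ← hprod, h1, List.length_eraseIdx_of_lt hi, abs_le] at h2
      rw [List.length_append, List.length_singleton] at h2
      have : 1 ≤ ω.length := by omega
      push_cast [this] at h2
      split_ifs at h2 <;> omega
    have h1 : invParity cs hM u (cs.wordProd ω * cs.simple b * (cs.wordProd ω)⁻¹) ≠ 0 := by
      have := (isRightDescent_iff_invParity cs hM).1 hbw
      rwa [hw, invParity_mul, h0, zero_add] at this
    have h2 := length_mul_lt_of_invParity_ne_zero cs hM h1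
    refine ⟨u * (cs.wordProd ω * cs.simple b * (cs.wordProd ω)⁻¹), ω ++ [b], hb', hmem',
      by simp [hlen], ?_, ?_⟩
    · rw [hprod, hw]
      simp [mul_assoc]
    · have h3 := cs.length_mul_le (u * (cs.wordProd ω * cs.simple b * (cs.wordProd ω)⁻¹))
        (cs.wordProd (ω ++ [b]))
      rw [show u * (cs.wordProd ω * cs.simple b * (cs.wordProd ω)⁻¹) *
        cs.wordProd (ω ++ [b]) = w by rw [hprod, hw]; simp [mul_assoc]] at h3
      have h4 := cs.length_wordProd_le (ω ++ [b])
      rw [List.length_append, List.length_singleton] at h4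
      omega

theorem not_isRightDescent_of_isRightDescent {s t : S} (h : M s t = 0) {w : W}
    (hs : cs.IsRightDescent w s) : ¬ cs.IsRightDescent w t := by
  intro ht
  obtain ⟨u, ω, -, -, -, -, hu⟩ := exists_alternating_suffix cs hM h hs ht (cs.length w + 1)
  omega

theorem not_isLeftDescent_of_isLeftDescent {s t : S} (h : M s t = 0) {w : W}
    (hs : cs.IsLeftDescent w s) : ¬ cs.IsLeftDescent w t := by
  rw [← cs.isRightDescent_inv_iff] at hs ⊢
  exact not_isRightDescent_of_isRightDescent cs hM h hs

end Infinite

/-! ### The non-commutation graph -/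

section Graph

variable {S : Type*} {M : CoxeterMatrix S}

theorem eq_zero_symm {s t : S} (h : M s t = 0) : M t s = 0 := by rwa [M.symmetric]

theorem IsRightAngled.eq_two (hM : IsRightAngled M) {s t : S} (hst : s ≠ t) (h : M s t ≠ 0) :
    M s t = 2 := (hM s t hst).resolve_right h

theorem reflTransGen_of_isIrreducible (hM : IsRightAngled M) (hirr : IsIrreducible M) (a b : S) :
    Relation.ReflTransGen (fun s t => M s t = 0) a b := by
  by_contra hb
  refine hirr ⟨{c | Relation.ReflTransGen (fun s t => M s t = 0) a c}, ⟨a, .refl⟩, ⟨b, hb⟩, ?_⟩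
  intro s hs t ht
  refine hM.eq_two ?_ fun h => ht (Relation.ReflTransGen.tail hs h)
  rintro rfl
  exact ht hs

/-- As there are at least three generators, every edge of the non-commutation graph has an adjacent
edge. -/
theorem exists_adjacent_edge [Finite S] (hM : IsRightAngled M) (hirr : IsIrreducible M)
    (hS : 3 ≤ Nat.card S) (s t : S) :
    ∃ c, c ≠ s ∧ c ≠ t ∧ (M c t = 0 ∨ M c s = 0) := by
  by_contra! h
  refine hirr ⟨{s, t}, ⟨s, by simp⟩, ?_, ?_⟩
  · rw [Set.nonempty_compl]
    intro hu
    have h1 := Set.ncard_univ S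
    rw [← hu] at h1
    have h2 := Set.ncard_insert_le s {t}
    rw [Set.ncard_singleton] at h2
    omega
  · intro u hu c hc
    rw [Set.mem_compl_iff, Set.mem_insert_iff, Set.mem_singleton_iff, not_or] at hc
    have := h c hc.1 hc.2
    rcases hu with rfl | rfl
    · exact hM.eq_two (Ne.symm hc.1) fun h0 => this.2 (eq_zero_symm h0)
    · exact hM.eq_two (Ne.symm hc.2) fun h0 => this.1 (eq_zero_symm h0)

theorem exists_eq_zero [Finite S] (hM : IsRightAngled M) (hirr : IsIrreducible M)
    (hS : 3 ≤ Nat.card S) (s : S) : ∃ c, M c s = 0 := by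
  obtain ⟨c, -, -, h | h⟩ := exists_adjacent_edge hM hirr hS s s <;> exact ⟨c, h⟩

theorem exists_two_neighbours [Finite S] (hM : IsRightAngled M) (hirr : IsIrreducible M)
    (hS : 3 ≤ Nat.card S) : ∃ b x y : S, x ≠ y ∧ M x b = 0 ∧ M y b = 0 := by
  have : Nonempty S := by
    by_contra h
    rw [not_nonempty_iff] at h
    rw [Nat.card_of_isEmpty] at hS
    omega
  obtain ⟨s⟩ := this
  obtain ⟨t, hts⟩ := exists_eq_zero hM hirr hS s
  obtain ⟨c, hcs, hct, h | h⟩ := exists_adjacent_edge hM hirr hS s t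
  · exact ⟨t, c, s, hcs, h, eq_zero_symm hts⟩
  · exact ⟨s, c, t, hct, h, hts⟩

/-- Paths in the non-commutation graph, written from right to left, can be continued to any
vertex. -/
theorem exists_chain_extension (hM : IsRightAngled M) (hirr : IsIrreducible M) {a : S} {m : List S}
    (hm : (a :: m).IsChain (fun s t => M s t = 0)) (b : S) :
    ∃ m', (b :: m').IsChain (fun s t => M s t = 0) ∧ a :: m <:+ b :: m' := by
  induction reflTransGen_of_isIrreducible hM hirr a b with
  | refl => exact ⟨m, hm, List.suffix_rfl⟩
  | @tail c d _ hcd ih =>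
    obtain ⟨m', h1, h2⟩ := ih
    exact ⟨c :: m', List.isChain_cons_cons.2 ⟨eq_zero_symm hcd, h1⟩,
      h2.trans (List.suffix_cons d _)⟩

end Graph

/-! ### Conjugating a group element to infinity -/

section Growth

variable {S W : Type*} [Group W] {M : CoxeterMatrix S} (cs : CoxeterSystem M W)

/-- The conjugate of `g` by the product of the word `l`. -/
def conjWord (l : List S) (g : W) : W := cs.wordProd l * g * (cs.wordProd l)⁻¹

theorem conjWord_cons (b : S) (l : List S) (g : W) :
    conjWord cs (b :: l) g = cs.simple b * conjWord cs l g * cs.simple b := by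
  simp [conjWord, cs.wordProd_cons, mul_assoc]

theorem conjWord_inv (l : List S) (g : W) : conjWord cs l g⁻¹ = (conjWord cs l g)⁻¹ := by
  simp [conjWord, mul_assoc]

theorem conjWord_ne_one (l : List S) {g : W} (hg : g ≠ 1) : conjWord cs l g ≠ 1 := by
  simpa [conjWord] using hg

/-- `g` is a reduced product `b g' b` with a `g'` that does not commute with `b`. -/
def IsGrown (b : S) (g : W) : Prop :=
  cs.IsLeftDescent g b ∧ cs.IsRightDescent g b ∧ cs.simple b * g ≠ g * cs.simple b

/-- Conjugation by `b` increases the length of `g`. -/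
def IsGrowing (b : S) (g : W) : Prop :=
  ¬ cs.IsLeftDescent g b ∧ ¬ cs.IsRightDescent g b ∧ cs.simple b * g ≠ g * cs.simple b

theorem simple_mul_conj_eq_iff (b : S) (g : W) :
    cs.simple b * (cs.simple b * g * cs.simple b) = cs.simple b * g * cs.simple b * cs.simple b ↔
      cs.simple b * g = g * cs.simple b := by
  simp [mul_assoc, eq_comm]

variable {cs} (hM : IsRightAngled M)
include hM

theorem IsGrowing.length_eq {b : S} {g : W} (h : IsGrowing cs b g) :
    cs.length (cs.simple b * g * cs.simple b) = cs.length g + 2 := by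
  have h1 := not_isRightDescent_simple_mul cs hM h.2.1 h.2.2
  rw [cs.not_isRightDescent_iff.1 h1, cs.not_isLeftDescent_iff.1 h.1]

theorem IsGrowing.isGrown {b : S} {g : W} (h : IsGrowing cs b g) :
    IsGrown cs b (cs.simple b * g * cs.simple b) := by
  refine ⟨?_, ?_, fun h' => h.2.2 ((simple_mul_conj_eq_iff cs b g).1 h')⟩
  · rw [mul_assoc, cs.isLeftDescent_iff_not_isLeftDescent_mul, cs.simple_mul_simple_cancel_left,
      isLeftDescent_mul_simple_iff cs hM h.2.2]
    exact h.1
  · rw [cs.isRightDescent_iff_not_isRightDescent_mul, cs.simple_mul_simple_cancel_right,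
      isRightDescent_simple_mul_iff cs hM h.2.2]
    exact h.2.1

/-- Growth under conjugation persists along paths in the non-commutation graph. -/
theorem IsGrown.isGrowing {b c : S} {g : W} (h : IsGrown cs b g) (hcb : M c b = 0) :
    IsGrowing cs c g := by
  have hbc := eq_zero_symm hcb
  have hl := not_isLeftDescent_of_isLeftDescent cs hM hbc h.1
  refine ⟨hl, not_isRightDescent_of_isRightDescent cs hM hbc h.2.1, fun he => ?_⟩
  have h1 := (isLeftDescent_mul_simple_iff cs hM
    (simple_mul_ne_mul_simple cs hM (ne_of_eq_zero hbc) g)).2 h.1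
  rw [← he] at h1
  refine not_isLeftDescent_of_isLeftDescent cs hM hbc h1 ?_
  rw [cs.isLeftDescent_iff_not_isLeftDescent_mul, cs.simple_mul_simple_cancel_left]
  exact hl

theorem IsGrown.extend {g : W} {b c : S} {m m' : List S}
    (h : IsGrown cs b (conjWord cs (b :: m) g)) (hm' : (c :: m').IsChain (fun s t => M s t = 0))
    (hs : b :: m <:+ c :: m') : IsGrown cs c (conjWord cs (c :: m') g) := by
  induction m' generalizing c with
  | nil =>
    have := hs.eq_of_length_le (by simp)
    simp only [List.cons.injEq] at this
    obtain ⟨rfl, rfl⟩ := this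
    exact h
  | cons d m' ih =>
    rcases List.suffix_cons_iff.1 hs with h' | h'
    · simp only [List.cons.injEq] at h'
      obtain ⟨rfl, rfl⟩ := h'
      exact h
    · rw [List.isChain_cons_cons] at hm'
      rw [conjWord_cons]
      exact ((ih hm'.2 h').isGrowing hM hm'.1).isGrown hM

variable (cs)

/-- Conjugation by `b` either fixes `h` or is a cyclic shift of a letter `b` from one end of `h` to
the other. -/
def IsShift (b : S) (h : W) : Prop :=
  cs.simple b * h = h * cs.simple b ∨ (cs.IsLeftDescent h b ∧ ¬ cs.IsRightDescent h b) ∨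
    (cs.IsRightDescent h b ∧ ¬ cs.IsLeftDescent h b)

omit hM in
theorem IsShift.inv {b : S} {h : W} (H : IsShift cs b h) : IsShift cs b h⁻¹ := by
  simp only [IsShift, cs.isLeftDescent_inv_iff, cs.isRightDescent_inv_iff]
  refine H.imp (fun e => ?_) Or.symm
  rw [← inv_inj]
  simpa using e.symm

/-- A letter that has been shifted from the left to the right end forces all later steps to be
shifts of the same kind. At a vertex with two neighbours `x`, `y` this is impossible: both `x` and
`y` are letters at the left end, and after `x` has been shifted, `y` blocks the way. -/
theorem false_of_shift [Finite S] (hirr : IsIrreducible M) (hS : 3 ≤ Nat.card S) {g : W} {a b : S}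
    {m : List S} (hm : (b :: a :: m).IsChain (fun s t => M s t = 0))
    (hstep : ∀ c d m', (d :: c :: m').IsChain (fun s t => M s t = 0) → a :: m <:+ c :: m' →
      IsShift cs d (conjWord cs (c :: m') g))
    (hl : cs.IsLeftDescent (conjWord cs (a :: m) g) b)
    (hr : ¬ cs.IsRightDescent (conjWord cs (a :: m) g) b) : False := by
  -- the state after a shift from left to right
  have hshift : ∀ (c : S) (h : W), cs.IsLeftDescent h c → ¬ cs.IsRightDescent h c →
      cs.IsRightDescent (cs.simple c * h * cs.simple c) c ∧
        ¬ cs.IsLeftDescent (cs.simple c * h * cs.simple c) c := by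
    intro c h h1 h2
    have hne : cs.simple c * h ≠ h * cs.simple c := by
      intro he
      rw [CoxeterSystem.IsLeftDescent, he] at h1
      exact h2 h1
    constructor
    · rw [cs.isRightDescent_iff_not_isRightDescent_mul, cs.simple_mul_simple_cancel_right,
        isRightDescent_simple_mul_iff cs hM hne]
      exact h2
    · rw [cs.isLeftDescent_iff_not_isLeftDescent_mul, not_not, mul_assoc,
        cs.simple_mul_simple_cancel_left, isLeftDescent_mul_simple_iff cs hM hne]
      exact h1
  have hnext : ∀ c d m', (d :: c :: m').IsChain (fun s t => M s t = 0) → a :: m <:+ c :: m' →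
      cs.IsRightDescent (conjWord cs (c :: m') g) c →
      cs.IsLeftDescent (conjWord cs (c :: m') g) d ∧
        ¬ cs.IsRightDescent (conjWord cs (c :: m') g) d := by
    intro c d m' hc hs h1
    have hdc : M d c = 0 := (List.isChain_cons_cons.1 hc).1
    have h3 := not_isRightDescent_of_isRightDescent cs hM (eq_zero_symm hdc) h1
    rcases hstep c d m' hc hs with h | h | h
    · exfalso
      have h4 := (isRightDescent_simple_mul_iff cs hM
        (simple_mul_ne_mul_simple cs hM (ne_of_eq_zero hdc) _)).2 h1
      rw [h] at h4
      refine not_isRightDescent_of_isRightDescent cs hM (eq_zero_symm hdc) h4 ?_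
      rw [cs.isRightDescent_iff_not_isRightDescent_mul, cs.simple_mul_simple_cancel_right]
      exact h3
    · exact h
    · exact absurd h.1 h3
  have hpers : ∀ m' c, (c :: m').IsChain (fun s t => M s t = 0) → b :: a :: m <:+ c :: m' →
      cs.IsRightDescent (conjWord cs (c :: m') g) c := by
    intro m'
    induction m' with
    | nil =>
      intro c _ hs
      have := hs.length_le
      simp at this
    | cons d m' ih =>
      intro c hc hs
      rw [conjWord_cons]
      rcases List.suffix_cons_iff.1 hs with h' | h'
      · simp only [List.cons.injEq] at h'
        obtain ⟨rfl, rfl, rfl⟩ := h'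
        exact (hshift _ _ hl hr).1
      · have h1 := hnext d c m' hc ((List.suffix_cons b _).trans h')
          (ih d (List.isChain_cons_cons.1 hc).2 h')
        exact (hshift _ _ h1.1 h1.2).1
  obtain ⟨β, x, y, hxy, hx, hy⟩ := exists_two_neighbours hM hirr hS
  obtain ⟨m', hc, hs⟩ := exists_chain_extension hM hirr hm β
  have hs' := (List.suffix_cons b _).trans hs
  have hβ := hpers m' β hc hs
  have hcx : (x :: β :: m').IsChain (fun s t => M s t = 0) := List.isChain_cons_cons.2 ⟨hx, hc⟩
  have h1 := hnext β x m' hcx hs' hβ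
  have h2 := hnext β y m' (List.isChain_cons_cons.2 ⟨hy, hc⟩) hs' hβ
  have hcomm : M x y = 2 := hM.eq_two hxy fun h0 =>
    not_isLeftDescent_of_isLeftDescent cs hM h0 h1.1 h2.1
  have h3 := (hnext x β (β :: m') (List.isChain_cons_cons.2 ⟨eq_zero_symm hx, hcx⟩)
    (hs'.trans (List.suffix_cons x _))
    (hpers _ _ hcx (hs.trans (List.suffix_cons x _)))).1
  refine not_isLeftDescent_of_isLeftDescent cs hM (eq_zero_symm hy) h3 ?_
  rw [conjWord_cons, isLeftDescent_mul_simple_iff cs hM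
    (simple_mul_ne_mul_simple cs hM hxy.symm _), isLeftDescent_simple_mul_iff_of_comm cs hM hcomm]
  exact h2.1

/-- An element that commutes with all generators is trivial. -/
theorem eq_one_of_commute [Finite S] (hirr : IsIrreducible M) (hS : 3 ≤ Nat.card S) {h : W}
    (hc : ∀ s, cs.simple s * h = h * cs.simple s) : h = 1 := by
  by_contra hne
  obtain ⟨s, hs⟩ := cs.exists_leftDescent_of_ne_one hne
  obtain ⟨t, hts⟩ := exists_eq_zero hM hirr hS s
  have hst := eq_zero_symm hts
  have h1 := (isLeftDescent_mul_simple_iff cs hM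
    (simple_mul_ne_mul_simple cs hM (ne_of_eq_zero hst) h)).2 hs
  rw [← hc t] at h1
  refine not_isLeftDescent_of_isLeftDescent cs hM hst h1 ?_
  rw [cs.isLeftDescent_iff_not_isLeftDescent_mul, cs.simple_mul_simple_cancel_left]
  exact not_isLeftDescent_of_isLeftDescent cs hM hst hs

/-- Every non-trivial element grows under conjugation along a suitable continuation of any path in
the non-commutation graph. -/
theorem exists_isGrown [Finite S] (hirr : IsIrreducible M) (hS : 3 ≤ Nat.card S) {g : W}
    (hg : g ≠ 1) {a : S} {m : List S} (hm : (a :: m).IsChain (fun s t => M s t = 0)) :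
    ∃ b m', (b :: m').IsChain (fun s t => M s t = 0) ∧ a :: m <:+ b :: m' ∧
      IsGrown cs b (conjWord cs (b :: m') g) := by
  -- otherwise consider a continuation with a conjugate of minimal length
  induction hn : cs.length (conjWord cs (a :: m) g) using Nat.strong_induction_on
    generalizing a m with
  | _ n ih =>
  by_contra! hno
  have hmin : ∀ b m', (b :: m').IsChain (fun s t => M s t = 0) → a :: m <:+ b :: m' →
      n ≤ cs.length (conjWord cs (b :: m') g) := by
    intro b m' hb hs
    by_contra! hlt
    obtain ⟨c, m'', h1, h2, h3⟩ := ih _ hlt hb rfl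
    exact hno c m'' h1 (hs.trans h2) h3
  have hgrowing : ∀ b c m', (c :: b :: m').IsChain (fun s t => M s t = 0) → a :: m <:+ b :: m' →
      ¬ IsGrowing cs c (conjWord cs (b :: m') g) := by
    intro b c m' hc hs hgr
    refine hno c (b :: m') hc (hs.trans (List.suffix_cons c _)) ?_
    rw [conjWord_cons]
    exact hgr.isGrown hM
  have hconj : ∀ b (h : W), ¬ IsGrowing cs b h →
      cs.length (cs.simple b * h * cs.simple b) ≤ cs.length h := by
    intro b h hgr
    by_cases hcomm : cs.simple b * h = h * cs.simple b
    · rw [hcomm, cs.simple_mul_simple_cancel_right]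
    · by_cases h1 : cs.IsLeftDescent h b
      · have := cs.isLeftDescent_iff.1 h1
        rcases cs.length_mul_simple (cs.simple b * h) b with h2 | h2 <;> omega
      · have h2 : cs.IsRightDescent h b := by
          by_contra h2
          exact hgr ⟨h1, h2, hcomm⟩
        have := cs.isRightDescent_iff.1 h2
        rw [mul_assoc]
        rcases cs.length_simple_mul (h * cs.simple b) b with h2 | h2 <;> omega
  have hsame : ∀ m' b, (b :: m').IsChain (fun s t => M s t = 0) → a :: m <:+ b :: m' →
      cs.length (conjWord cs (b :: m') g) = n := by
    intro m'
    induction m' with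
    | nil =>
      intro b _ hs
      rw [← hs.eq_of_length_le (by simp)]
      exact hn
    | cons c m' ihm =>
      intro b hb hs
      rcases List.suffix_cons_iff.1 hs with h' | h'
      · rw [← h']
        exact hn
      · refine le_antisymm ?_ (hmin _ _ hb hs)
        rw [conjWord_cons, ← ihm c (List.isChain_cons_cons.1 hb).2 h']
        exact hconj _ _ (hgrowing c b m' hb h')
  have hstep : ∀ c d m', (d :: c :: m').IsChain (fun s t => M s t = 0) → a :: m <:+ c :: m' →
      IsShift cs d (conjWord cs (c :: m') g) := by
    intro c d m' hd hs
    have h1 := hsame _ _ (List.isChain_cons_cons.1 hd).2 hs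
    have h2 := hsame _ _ hd (hs.trans (List.suffix_cons d _))
    rw [← h1, conjWord_cons] at h2
    have h3 := hgrowing c d m' hd hs
    generalize conjWord cs (c :: m') g = h at h2 h3
    by_cases hcomm : cs.simple d * h = h * cs.simple d
    · exact Or.inl hcomm
    · refine Or.inr ?_
      by_cases hl : cs.IsLeftDescent h d <;> by_cases hr : cs.IsRightDescent h d
      · exfalso
        have h4 := (isRightDescent_simple_mul_iff cs hM hcomm).2 hr
        rw [cs.isRightDescent_iff] at h4
        rw [cs.isLeftDescent_iff] at hl
        omega
      · exact Or.inl ⟨hl, hr⟩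
      · exact Or.inr ⟨hr, hl⟩
      · exact absurd ⟨hl, hr, hcomm⟩ h3
  have hcomm : ∀ c d m', (d :: c :: m').IsChain (fun s t => M s t = 0) → a :: m <:+ c :: m' →
      cs.simple d * conjWord cs (c :: m') g = conjWord cs (c :: m') g * cs.simple d := by
    intro c d m' hd hs
    rcases hstep c d m' hd hs with h | h | h
    · exact h
    · exact (false_of_shift cs hM hirr hS hd
        (fun c' d' m'' hd' hs' => hstep c' d' m'' hd' (hs.trans hs')) h.1 h.2).elim
    · refine (false_of_shift cs hM hirr hS (g := g⁻¹) hd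
        (fun c' d' m'' hd' hs' => ?_) ?_ ?_).elim
      · rw [conjWord_inv]
        exact (hstep c' d' m'' hd' (hs.trans hs')).inv
      · rw [conjWord_inv, cs.isLeftDescent_inv_iff]
        exact h.1
      · rw [conjWord_inv, cs.isRightDescent_inv_iff]
        exact h.2
  have hconst : ∀ m' b, (b :: m').IsChain (fun s t => M s t = 0) → a :: m <:+ b :: m' →
      conjWord cs (b :: m') g = conjWord cs (a :: m) g := by
    intro m'
    induction m' with
    | nil =>
      intro b _ hs
      rw [← hs.eq_of_length_le (by simp)]
    | cons c m' ihm =>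
      intro b hb hs
      rcases List.suffix_cons_iff.1 hs with h' | h'
      · rw [← h']
      · rw [conjWord_cons, hcomm c b m' hb h', cs.simple_mul_simple_cancel_right]
        exact ihm c (List.isChain_cons_cons.1 hb).2 h'
  refine conjWord_ne_one cs (a :: m) hg (eq_one_of_commute cs hM hirr hS fun s => ?_)
  obtain ⟨t, hts⟩ := exists_eq_zero hM hirr hS s
  obtain ⟨m', h1, h2⟩ := exists_chain_extension hM hirr hm t
  have := hcomm t s m' (List.isChain_cons_cons.2 ⟨eq_zero_symm hts, h1⟩) h2
  rwa [hconst m' t h1 h2] at this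

end Growth

/-! ### The Hecke operators on functions -/

section Operators

variable {S W : Type*} [Group W] {M : CoxeterMatrix S} (cs : CoxeterSystem M W) (q : S → ℝ)

/-- The left action of `T_s` on all complex functions on `W`. -/
def leftOp (s : S) : Module.End ℂ (W → ℂ) where
  toFun := heckeLeftFun cs q s
  map_add' x y := by
    funext w
    simp only [heckeLeftFun, Pi.add_apply]
    split_ifs <;> ring
  map_smul' c x := by
    funext w
    simp only [heckeLeftFun, Pi.smul_apply, smul_eq_mul, RingHom.id_apply]
    split_ifs <;> ring

/-- The right action of `T_s` on all complex functions on `W`. -/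
def rightOp (s : S) : Module.End ℂ (W → ℂ) where
  toFun := heckeRightFun cs q s
  map_add' x y := by
    funext w
    simp only [heckeRightFun, Pi.add_apply]
    split_ifs <;> ring
  map_smul' c x := by
    funext w
    simp only [heckeRightFun, Pi.smul_apply, smul_eq_mul, RingHom.id_apply]
    split_ifs <;> ring

/-- The reflection `x ↦ (w ↦ x (w⁻¹))`, which interchanges the left and the right action. -/
def compInv (x : W → ℂ) (w : W) : ℂ := x w⁻¹

variable {cs} in
theorem leftOp_of_descent {s : S} {w : W} (h : cs.IsLeftDescent w s) (x : W → ℂ) :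
    leftOp cs q s x w = x (cs.simple s * w) + pCoeff q s * x w := by
  exact congrArg (x _ + ·) (if_pos h)

variable {cs} in
theorem leftOp_of_not_descent {s : S} {w : W} (h : ¬ cs.IsLeftDescent w s) (x : W → ℂ) :
    leftOp cs q s x w = x (cs.simple s * w) := by
  exact (congrArg (x _ + ·) (if_neg h)).trans (add_zero _)

variable {cs} in
theorem rightOp_of_descent {s : S} {w : W} (h : cs.IsRightDescent w s) (x : W → ℂ) :
    rightOp cs q s x w = x (w * cs.simple s) + pCoeff q s * x w := by
  exact congrArg (x _ + ·) (if_pos h)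

variable {cs} in
theorem rightOp_of_not_descent {s : S} {w : W} (h : ¬ cs.IsRightDescent w s) (x : W → ℂ) :
    rightOp cs q s x w = x (w * cs.simple s) := by
  exact (congrArg (x _ + ·) (if_neg h)).trans (add_zero _)

theorem leftOp_compInv (s : S) (x : W → ℂ) :
    leftOp cs q s (compInv x) = compInv (rightOp cs q s x) := by
  funext w
  rw [compInv]
  by_cases h : cs.IsLeftDescent w s
  · rw [leftOp_of_descent q h, rightOp_of_descent q (cs.isRightDescent_inv_iff.2 h)]
    simp [compInv]
  · rw [leftOp_of_not_descent q h,
      rightOp_of_not_descent q (fun h' => h (cs.isRightDescent_inv_iff.1 h'))]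
    simp [compInv]

theorem compInv_compInv (x : W → ℂ) : compInv (compInv x) = x := by
  funext w
  simp [compInv]

theorem rightOp_compInv (s : S) (x : W → ℂ) :
    rightOp cs q s (compInv x) = compInv (leftOp cs q s x) := by
  rw [← compInv_compInv (rightOp cs q s (compInv x)), ← leftOp_compInv, compInv_compInv]

/-- The Hecke relation `T_s² = 1 + p_s T_s`. -/
theorem leftOp_mul_self (s : S) :
    leftOp cs q s * leftOp cs q s = 1 + (pCoeff q s : ℂ) • leftOp cs q s := by
  ext1 x
  funext w
  simp only [Module.End.mul_apply, LinearMap.add_apply, Module.End.one_apply, LinearMap.smul_apply,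
    Pi.add_apply, Pi.smul_apply, smul_eq_mul]
  by_cases h : cs.IsLeftDescent w s
  · have h' := cs.isLeftDescent_iff_not_isLeftDescent_mul.1 h
    rw [leftOp_of_descent q h, leftOp_of_not_descent q h', cs.simple_mul_simple_cancel_left]
  · have h' : cs.IsLeftDescent (cs.simple s * w) s := by
      rwa [cs.isLeftDescent_iff_not_isLeftDescent_mul, cs.simple_mul_simple_cancel_left]
    rw [leftOp_of_not_descent q h, leftOp_of_descent q h', cs.simple_mul_simple_cancel_left,
      leftOp_of_not_descent q h]

variable (hM : IsRightAngled M)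
include hM

/-- The left and the right action commute. -/
theorem leftOp_comm_rightOp (s t : S) : Commute (leftOp cs q s) (rightOp cs q t) := by
  ext1 x
  funext w
  simp only [Module.End.mul_apply]
  by_cases hne : cs.simple s * w = w * cs.simple t
  · have hst : s = t := by
      by_contra hst
      exact simple_mul_ne_mul_simple cs hM hst w hne
    subst hst
    have hiff : ∀ v : W, cs.simple s * v = v * cs.simple s →
        (cs.IsLeftDescent v s ↔ cs.IsRightDescent v s) := by
      intro v hv
      rw [CoxeterSystem.IsLeftDescent, CoxeterSystem.IsRightDescent, hv]
    have hne' : cs.simple s * (cs.simple s * w) = cs.simple s * w * cs.simple s := by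
      rw [mul_assoc, hne]
    have heq : ∀ (y : W → ℂ) (v : W), cs.simple s * v = v * cs.simple s →
        leftOp cs q s y v = rightOp cs q s y v := by
      intro y v hv
      by_cases h : cs.IsLeftDescent v s
      · rw [leftOp_of_descent q h, rightOp_of_descent q ((hiff v hv).1 h), hv]
      · rw [leftOp_of_not_descent q h,
          rightOp_of_not_descent q (fun h' => h ((hiff v hv).2 h')), hv]
    by_cases h : cs.IsLeftDescent w s
    · rw [leftOp_of_descent q h, rightOp_of_descent q ((hiff w hne).1 h) (leftOp cs q s x), ← hne,
        heq x _ hne', heq x _ hne]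
    · rw [leftOp_of_not_descent q h, rightOp_of_not_descent q (fun h' => h ((hiff w hne).2 h')),
        ← hne, heq x _ hne']
  · have h1 := isRightDescent_simple_mul_iff cs hM hne
    have h2 := isLeftDescent_mul_simple_iff cs hM hne
    by_cases hl : cs.IsLeftDescent w s <;> by_cases hr : cs.IsRightDescent w t
    · rw [leftOp_of_descent q hl, rightOp_of_descent q hr, rightOp_of_descent q hr,
        rightOp_of_descent q (h1.2 hr), leftOp_of_descent q hl, leftOp_of_descent q (h2.2 hl),
        mul_assoc]
      ring
    · rw [leftOp_of_descent q hl, rightOp_of_not_descent q hr, rightOp_of_not_descent q hr,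
        rightOp_of_not_descent q (fun h => hr (h1.1 h)), leftOp_of_descent q (h2.2 hl), mul_assoc]
    · rw [leftOp_of_not_descent q hl, rightOp_of_descent q hr,
        rightOp_of_descent q (h1.2 hr), leftOp_of_not_descent q hl,
        leftOp_of_not_descent q (fun h => hl (h2.1 h)), mul_assoc]
    · rw [leftOp_of_not_descent q hl, rightOp_of_not_descent q hr,
        rightOp_of_not_descent q (fun h => hr (h1.1 h)),
        leftOp_of_not_descent q (fun h => hl (h2.1 h)), mul_assoc]

theorem leftOp_comm_leftOp {s t : S} (hst : M s t = 2) :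
    Commute (leftOp cs q s) (leftOp cs q t) := by
  have hts : M t s = 2 := by rwa [M.symmetric]
  have hc := simple_mul_simple_comm cs hst
  ext1 x
  funext w
  simp only [Module.End.mul_apply]
  have h1 := isLeftDescent_simple_mul_iff_of_comm cs hM hst w
  have h2 := isLeftDescent_simple_mul_iff_of_comm cs hM hts w
  have h3 : cs.simple s * (cs.simple t * w) = cs.simple t * (cs.simple s * w) := by
    rw [← mul_assoc, hc, mul_assoc]
  by_cases hs : cs.IsLeftDescent w s <;> by_cases ht : cs.IsLeftDescent w t
  · rw [leftOp_of_descent q hs, leftOp_of_descent q ht, leftOp_of_descent q (h1.2 ht),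
      leftOp_of_descent q ht, leftOp_of_descent q hs, leftOp_of_descent q (h2.2 hs), h3]
    ring
  · rw [leftOp_of_descent q hs, leftOp_of_not_descent q ht,
      leftOp_of_not_descent q (fun h => ht (h1.1 h)), leftOp_of_not_descent q ht,
      leftOp_of_descent q (h2.2 hs), h3]
  · rw [leftOp_of_not_descent q hs, leftOp_of_descent q (h1.2 ht), leftOp_of_descent q ht,
      leftOp_of_not_descent q hs, leftOp_of_not_descent q (fun h => hs (h2.1 h)), h3]
  · rw [leftOp_of_not_descent q hs, leftOp_of_not_descent q ht,
      leftOp_of_not_descent q (fun h => ht (h1.1 h)),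
      leftOp_of_not_descent q (fun h => hs (h2.1 h)), h3]

end Operators

/-! ### Words of operators and central functions -/

section Words

variable {S W : Type*} [Group W] {M : CoxeterMatrix S} (cs : CoxeterSystem M W) (q : S → ℝ)

/-- The operator `x ↦ T_{s₁} ⋯ T_{sₙ} x`. -/
def leftWord (l : List S) : Module.End ℂ (W → ℂ) := (l.map (leftOp cs q)).prod

/-- The operator `x ↦ x T_{s₁} ⋯ T_{sₙ}`. -/
def rightWord (l : List S) : Module.End ℂ (W → ℂ) := (l.reverse.map (rightOp cs q)).prod

/-- The left action of the commutator `T_s T_t - T_t T_s`. -/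
def leftComm (s t : S) : Module.End ℂ (W → ℂ) :=
  leftOp cs q s * leftOp cs q t - leftOp cs q t * leftOp cs q s

/-- The right action of the commutator `T_s T_t - T_t T_s`. -/
def rightComm (s t : S) : Module.End ℂ (W → ℂ) :=
  rightOp cs q t * rightOp cs q s - rightOp cs q s * rightOp cs q t

/-- `T_s x = x T_s` for all generators `s`. -/
def IsCentral (x : W → ℂ) : Prop := ∀ s, leftOp cs q s x = rightOp cs q s x

theorem leftWord_cons (s : S) (l : List S) :
    leftWord cs q (s :: l) = leftOp cs q s * leftWord cs q l := by
  simp [leftWord]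

theorem rightWord_cons (s : S) (l : List S) :
    rightWord cs q (s :: l) = rightWord cs q l * rightOp cs q s := by
  simp [rightWord]

theorem rightWord_compInv (l : List S) (x : W → ℂ) :
    rightWord cs q l (compInv x) = compInv (leftWord cs q l.reverse x) := by
  rw [rightWord, leftWord]
  generalize l.reverse = m
  induction m with
  | nil => rfl
  | cons s m ih =>
    rw [List.map_cons, List.map_cons, List.prod_cons, List.prod_cons, Module.End.mul_apply, ih,
      rightOp_compInv, Module.End.mul_apply]

theorem leftComm_swap (s t : S) : leftComm cs q t s = -leftComm cs q s t := by
  simp [leftComm]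

theorem rightComm_compInv (s t : S) (x : W → ℂ) :
    rightComm cs q s t (compInv x) = compInv (leftComm cs q t s x) := by
  simp only [rightComm, leftComm, LinearMap.sub_apply, Module.End.mul_apply, rightOp_compInv]
  rfl

variable {cs q} in
theorem isCentral_compInv {x : W → ℂ} (hx : IsCentral cs q x) : IsCentral cs q (compInv x) := by
  intro s
  rw [leftOp_compInv, rightOp_compInv, hx s]

variable (hM : IsRightAngled M)
include hM

theorem leftWord_comm_rightWord (l m : List S) :
    Commute (leftWord cs q l) (rightWord cs q m) := by
  refine Commute.list_prod_left _ _ fun a ha => Commute.list_prod_right _ _ fun b hb => ?_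
  rw [List.mem_map] at ha hb
  obtain ⟨s, -, rfl⟩ := ha
  obtain ⟨t, -, rfl⟩ := hb
  exact leftOp_comm_rightOp cs q hM s t

variable {cs q}

theorem IsCentral.leftWord_eq {x : W → ℂ} (hx : IsCentral cs q x) (l : List S) :
    leftWord cs q l x = rightWord cs q l x := by
  induction l with
  | nil => rfl
  | cons s l ih =>
    have h := congrArg (· x) ((leftWord_comm_rightWord cs q hM [s] l).eq)
    simp only [leftWord, List.map_singleton, List.prod_singleton, Module.End.mul_apply] at h
    rw [leftWord_cons, rightWord_cons, Module.End.mul_apply, Module.End.mul_apply, ih, h, hx s]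

theorem IsCentral.leftComm_eq {x : W → ℂ} (hx : IsCentral cs q x) (s t : S) :
    leftComm cs q s t x = rightComm cs q s t x := by
  have h1 := hx.leftWord_eq hM [s, t]
  have h2 := hx.leftWord_eq hM [t, s]
  simp only [leftWord, rightWord, List.map_cons, List.prod_cons, List.map_nil, List.prod_nil,
    mul_one, List.reverse_cons, List.reverse_nil, List.nil_append, List.cons_append] at h1 h2
  rw [leftComm, rightComm, LinearMap.sub_apply, LinearMap.sub_apply, h1, h2]

theorem leftComm_comm_rightComm (s t s' t' : S) :
    Commute (leftComm cs q s t) (rightComm cs q s' t') := by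
  have h := leftOp_comm_rightOp cs q hM
  exact (((h s t').mul_left (h t t')).mul_right ((h s s').mul_left (h t s'))).sub_right
    (((h s s').mul_left (h t s')).mul_right ((h s t').mul_left (h t t'))) |>.sub_left
    ((((h t t').mul_left (h s t')).mul_right ((h t s').mul_left (h s s'))).sub_right
    (((h t s').mul_left (h s s')).mul_right ((h t t').mul_left (h s t'))))

theorem leftWord_comm_rightComm (l : List S) (s t : S) :
    Commute (leftWord cs q l) (rightComm cs q s t) := by
  have h1 := leftWord_comm_rightWord cs q hM l [s, t]
  have h2 := leftWord_comm_rightWord cs q hM l [t, s]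
  simp only [rightWord, List.map_cons, List.prod_cons, List.map_nil, List.prod_nil,
    mul_one, List.reverse_cons, List.reverse_nil, List.nil_append, List.cons_append] at h1 h2
  exact h1.sub_right h2

theorem leftComm_comm_rightWord (s t : S) (l : List S) :
    Commute (leftComm cs q s t) (rightWord cs q l) := by
  have h1 := leftWord_comm_rightWord cs q hM [s, t] l
  have h2 := leftWord_comm_rightWord cs q hM [t, s] l
  simp only [leftWord, List.map_cons, List.prod_cons, List.map_nil, List.prod_nil,
    mul_one] at h1 h2
  exact h1.sub_left h2

/-- The identity `k T_v (k' x) = (k x) T_v k'` for central `x`, where `k = T_s T_t - T_t T_s` and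
`k' = T_{s'} T_{t'} - T_{t'} T_{s'}`. -/
theorem IsCentral.leftComm_leftWord_leftComm {x : W → ℂ} (hx : IsCentral cs q x)
    (s t s' t' : S) (l : List S) :
    leftComm cs q s t (leftWord cs q l (leftComm cs q s' t' x)) =
      rightComm cs q s' t' (rightWord cs q l (leftComm cs q s t x)) := by
  have h1 : leftComm cs q s t (leftWord cs q l x) = rightWord cs q l (leftComm cs q s t x) := by
    have h2 := hx.leftWord_eq hM (s :: t :: l)
    have h3 := hx.leftWord_eq hM (t :: s :: l)
    rw [leftWord_cons, leftWord_cons, rightWord_cons, rightWord_cons] at h2 h3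
    rw [hx.leftComm_eq hM]
    simp only [leftComm, rightComm, LinearMap.sub_apply, map_sub, Module.End.mul_apply] at h2 h3 ⊢
    rw [h2, h3]
  have h2 := congrArg (· x) (leftWord_comm_rightComm (cs := cs) (q := q) hM l s' t').eq
  have h3 := congrArg (· (leftWord cs q l x))
    (leftComm_comm_rightComm (cs := cs) (q := q) hM s t s' t').eq
  simp only [Module.End.mul_apply] at h2 h3
  rw [hx.leftComm_eq hM s' t', h2, h3, h1]

/-- The commutator `T_s T_t - T_t T_s` anticommutes with `T_s - p_s / 2`. -/
theorem IsCentral.leftOp_leftComm_add {x : W → ℂ} (hx : IsCentral cs q x) (s t : S) :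
    leftOp cs q s (leftComm cs q s t x) + rightOp cs q s (leftComm cs q s t x) =
      (pCoeff q s : ℂ) • leftComm cs q s t x := by
  have h1 : rightOp cs q s (leftComm cs q s t x) = leftComm cs q s t (leftOp cs q s x) := by
    have h := leftOp_comm_rightOp cs q hM
    have h2 : Commute (leftComm cs q s t) (rightOp cs q s) :=
      ((h s s).mul_left (h t s)).sub_left ((h t s).mul_left (h s s))
    have h3 := congrArg (· x) h2.eq
    simp only [Module.End.mul_apply] at h3
    rw [← h3, hx s]
  have h2 : leftOp cs q s * leftComm cs q s t + leftComm cs q s t * leftOp cs q s =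
      (pCoeff q s : ℂ) • leftComm cs q s t := by
    have h4 : leftOp cs q s * leftComm cs q s t + leftComm cs q s t * leftOp cs q s =
        (leftOp cs q s * leftOp cs q s) * leftOp cs q t -
          leftOp cs q t * (leftOp cs q s * leftOp cs q s) := by
      rw [leftComm]
      simp only [mul_sub, sub_mul, mul_assoc]
      abel
    rw [h4, leftOp_mul_self, leftComm]
    simp only [add_mul, mul_add, one_mul, mul_one, smul_mul_assoc, mul_smul_comm, smul_sub]
    abel
  rw [h1]
  exact congrArg (· x) h2

/-- If `s` and `c` commute, then so do `T_s` and `T_c`, and the commutators of both with `T_t` are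
related. -/
theorem IsCentral.leftOp_leftComm_sub {x : W → ℂ} (hx : IsCentral cs q x) {s c : S} (t : S)
    (hsc : M s c = 2) :
    leftOp cs q s (leftComm cs q c t x) - rightOp cs q s (leftComm cs q c t x) =
      leftOp cs q c (leftComm cs q s t x) - rightOp cs q c (leftComm cs q s t x) := by
  have h1 : ∀ a b : S, rightOp cs q a (leftComm cs q b t x) =
      leftComm cs q b t (leftOp cs q a x) := by
    intro a b
    have h := leftOp_comm_rightOp cs q hM
    have h2 : Commute (leftComm cs q b t) (rightOp cs q a) :=
      ((h b a).mul_left (h t a)).sub_left ((h t a).mul_left (h b a))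
    have h3 := congrArg (· x) h2.eq
    simp only [Module.End.mul_apply] at h3
    rw [← h3, hx a]
  have h2 : leftOp cs q s * leftComm cs q c t - leftComm cs q c t * leftOp cs q s =
      leftOp cs q c * leftComm cs q s t - leftComm cs q s t * leftOp cs q c := by
    have h3 := (leftOp_comm_leftOp cs q hM hsc).eq
    have h4 : leftOp cs q s * leftComm cs q c t - leftComm cs q c t * leftOp cs q s -
        (leftOp cs q c * leftComm cs q s t - leftComm cs q s t * leftOp cs q c) =
        (leftOp cs q s * leftOp cs q c - leftOp cs q c * leftOp cs q s) * leftOp cs q t +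
        leftOp cs q t * (leftOp cs q c * leftOp cs q s - leftOp cs q s * leftOp cs q c) := by
      rw [leftComm, leftComm]
      simp only [mul_sub, sub_mul, mul_assoc]
      abel
    rw [← sub_eq_zero, h4, h3]
    simp
  rw [h1, h1]
  exact congrArg (· x) h2

end Words

/-! ### The support of the commutators -/

section Support

open Filter Topology

variable {S W : Type*} [Group W] {M : CoxeterMatrix S} {cs : CoxeterSystem M W} {q : S → ℝ}

theorem tendsto_leftOp {x : W → ℂ} (hx : Tendsto x cofinite (𝓝 0)) (s : S) :
    Tendsto (leftOp cs q s x) cofinite (𝓝 0) := by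
  have h1 : Tendsto (fun w => x (cs.simple s * w)) cofinite (𝓝 0) :=
    hx.comp (mul_right_injective _).tendsto_cofinite
  have h2 : Tendsto (fun w => ‖x (cs.simple s * w)‖ + ‖(pCoeff q s : ℂ)‖ * ‖x w‖) cofinite
      (𝓝 0) := by
    simpa using h1.norm.add (hx.norm.const_mul ‖(pCoeff q s : ℂ)‖)
  refine squeeze_zero_norm (fun w => ?_) h2
  by_cases h : cs.IsLeftDescent w s
  · rw [leftOp_of_descent q h, ← norm_mul]
    exact norm_add_le _ _
  · rw [leftOp_of_not_descent q h]
    exact le_add_of_nonneg_right (by positivity)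

theorem tendsto_leftComm {x : W → ℂ} (hx : Tendsto x cofinite (𝓝 0)) (s t : S) :
    Tendsto (leftComm cs q s t x) cofinite (𝓝 0) := by
  have h := (tendsto_leftOp (cs := cs) (q := q) (tendsto_leftOp (cs := cs) (q := q) hx t) s).sub
    (tendsto_leftOp (cs := cs) (q := q) (tendsto_leftOp (cs := cs) (q := q) hx s) t)
  rw [sub_zero] at h
  exact h

theorem tendsto_compInv {x : W → ℂ} (hx : Tendsto x cofinite (𝓝 0)) :
    Tendsto (compInv x) cofinite (𝓝 0) :=
  hx.comp inv_injective.tendsto_cofinite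

variable (cs) in
/-- A function vanishing at infinity is small on elements of large length. -/
theorem exists_length_bound {x : W → ℂ} (hx : Tendsto x cofinite (𝓝 0)) {ε : ℝ} (hε : 0 < ε) :
    ∃ N, ∀ w, N ≤ cs.length w → ‖x w‖ < ε := by
  have h : {w | ¬ ‖x w‖ < ε}.Finite := by
    have := (Metric.tendsto_nhds.1 hx ε hε)
    simpa [dist_zero_right] using this
  obtain ⟨B, hB⟩ := (h.image cs.length).bddAbove
  refine ⟨B + 1, fun w hw => ?_⟩
  by_contra hc
  have := hB ⟨w, hc, rfl⟩
  omega

variable (hM : IsRightAngled M)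
include hM

/-- A function that is twisted central with respect to two non-commuting generators has constant
absolute value along the sequence of conjugates of `w` by `s`, `t`, `s`, …, if the length increases
in the first step. -/
theorem eq_zero_of_isGrowing {x : W → ℂ} (hx : Tendsto x cofinite (𝓝 0)) {s t : S}
    (hst : M s t = 0)
    (hs : leftOp cs q s x + rightOp cs q s x = (pCoeff q s : ℂ) • x)
    (ht : leftOp cs q t x + rightOp cs q t x = (pCoeff q t : ℂ) • x) {w : W}
    (hw : IsGrowing cs s w) : x w = 0 := by
  have step : ∀ (a : S), leftOp cs q a x + rightOp cs q a x = (pCoeff q a : ℂ) • x →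
      ∀ v, IsGrowing cs a v → x (cs.simple a * v * cs.simple a) = - x v := by
    intro a ha v hv
    have h1 := congrFun ha (cs.simple a * v)
    have hl : cs.IsLeftDescent (cs.simple a * v) a := by
      rw [cs.isLeftDescent_iff_not_isLeftDescent_mul, cs.simple_mul_simple_cancel_left]
      exact hv.1
    have hr := not_isRightDescent_simple_mul cs hM hv.2.1 hv.2.2
    rw [Pi.add_apply, leftOp_of_descent q hl, rightOp_of_not_descent q hr,
      cs.simple_mul_simple_cancel_left, Pi.smul_apply, smul_eq_mul] at h1
    linear_combination h1
  have iter : ∀ n, ∀ a b v, (a = s ∧ b = t ∨ a = t ∧ b = s) → IsGrowing cs a v →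
      ∃ u, n + cs.length v ≤ cs.length u ∧ ‖x u‖ = ‖x v‖ := by
    intro n
    induction n with
    | zero => exact fun a b v _ _ => ⟨v, (Nat.zero_add _).le, rfl⟩
    | succ n ih =>
      intro a b v hab hv
      have hab' : M b a = 0 ∧ leftOp cs q a x + rightOp cs q a x = (pCoeff q a : ℂ) • x := by
        rcases hab with ⟨rfl, rfl⟩ | ⟨rfl, rfl⟩
        · exact ⟨eq_zero_symm hst, hs⟩
        · exact ⟨hst, ht⟩
      obtain ⟨u, h1, h2⟩ := ih b a _ (hab.symm.imp And.symm And.symm)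
        ((hv.isGrown hM).isGrowing hM hab'.1)
      rw [hv.length_eq hM] at h1
      refine ⟨u, by omega, ?_⟩
      rw [h2, step a hab'.2 v hv, norm_neg]
  by_contra hne
  obtain ⟨N, hN⟩ := exists_length_bound cs hx (norm_pos_iff.2 hne)
  obtain ⟨u, hu, he⟩ := iter N s t w (Or.inl ⟨rfl, rfl⟩) hw
  exact (hN u (by omega)).ne he

omit hM in
/-- A twisted central function vanishes on the elements that commute with the generator. -/
theorem eq_zero_of_commute {x : W → ℂ} {s : S}
    (hs : leftOp cs q s x + rightOp cs q s x = (pCoeff q s : ℂ) • x) {w : W}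
    (hw : cs.simple s * w = w * cs.simple s) : x w = 0 := by
  have key : ∀ v, cs.simple s * v = v * cs.simple s → ¬ cs.IsLeftDescent v s →
      x v = 0 ∧ x (cs.simple s * v) = 0 := by
    intro v hv hl
    have hr : ¬ cs.IsRightDescent v s := by
      rwa [CoxeterSystem.IsRightDescent, ← hv]
    have hv' : cs.simple s * (cs.simple s * v) = cs.simple s * v * cs.simple s := by
      rw [mul_assoc, hv]
    have hl' : cs.IsLeftDescent (cs.simple s * v) s := by
      rwa [cs.isLeftDescent_iff_not_isLeftDescent_mul, cs.simple_mul_simple_cancel_left]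
    have hr' : cs.IsRightDescent (cs.simple s * v) s := by
      rwa [CoxeterSystem.IsRightDescent, ← hv']
    have h1 := congrFun hs v
    have h2 := congrFun hs (cs.simple s * v)
    rw [Pi.add_apply, leftOp_of_not_descent q hl, rightOp_of_not_descent q hr, ← hv,
      Pi.smul_apply, smul_eq_mul] at h1
    rw [Pi.add_apply, leftOp_of_descent q hl', rightOp_of_descent q hr', ← hv',
      cs.simple_mul_simple_cancel_left, Pi.smul_apply, smul_eq_mul] at h2
    have h3 : ((pCoeff q s ^ 2 + 4 : ℝ) : ℂ) ≠ 0 := by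
      rw [Complex.ofReal_ne_zero]
      positivity
    push_cast at h3
    have h4 : x v = 0 := by
      refine (mul_eq_zero.1 (?_ : ((pCoeff q s : ℂ) ^ 2 + 4) * x v = 0)).resolve_left h3
      linear_combination 2 * h2 - (pCoeff q s : ℂ) * h1
    refine ⟨h4, ?_⟩
    rw [h4] at h1
    linear_combination h1 / 2
  by_cases hl : cs.IsLeftDescent w s
  · have h1 := (key (cs.simple s * w) (by rw [mul_assoc, hw])
      (cs.isLeftDescent_iff_not_isLeftDescent_mul.1 hl)).2
    rwa [cs.simple_mul_simple_cancel_left] at h1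
  · exact (key w hw hl).1

/-- A twisted central function that vanishes where conjugation by `s` increases the length is
supported on the elements with `s` on exactly one end. -/
theorem leftDescent_iff_not_rightDescent {x : W → ℂ} {s : S}
    (hs : leftOp cs q s x + rightOp cs q s x = (pCoeff q s : ℂ) • x)
    (hgr : ∀ v, IsGrowing cs s v → x v = 0) {w : W} (hw : x w ≠ 0) :
    cs.IsLeftDescent w s ↔ ¬ cs.IsRightDescent w s := by
  have hne : cs.simple s * w ≠ w * cs.simple s := fun h => hw (eq_zero_of_commute hs h)
  refine ⟨fun hl hr => hw ?_, fun hr => ?_⟩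
  · have hl' : ¬ cs.IsLeftDescent (cs.simple s * w) s :=
      cs.isLeftDescent_iff_not_isLeftDescent_mul.1 hl
    have hr' := (isRightDescent_simple_mul_iff cs hM hne).2 hr
    have h1 := congrFun hs (cs.simple s * w)
    rw [Pi.add_apply, leftOp_of_not_descent q hl', rightOp_of_descent q hr',
      cs.simple_mul_simple_cancel_left, Pi.smul_apply, smul_eq_mul] at h1
    have h2 : x (cs.simple s * w * cs.simple s) = 0 := by
      refine hgr _ ⟨?_, cs.isRightDescent_iff_not_isRightDescent_mul.1 hr',
        fun h => hne ((simple_mul_conj_eq_iff cs s w).1 h)⟩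
      rw [mul_assoc, cs.isLeftDescent_iff_not_isLeftDescent_mul, not_not,
        cs.simple_mul_simple_cancel_left, isLeftDescent_mul_simple_iff cs hM hne]
      exact hl
    rw [h2] at h1
    linear_combination h1
  · by_contra hl
    exact hw (hgr w ⟨hl, hr, hne⟩)

/-- The commutator of `T_s` and `T_t` applied to a central function is supported on the elements
that have `s` on one end and `t` on the other end. -/
theorem IsCentral.support_leftComm {x : W → ℂ} (hx : IsCentral cs q x)
    (h0 : Tendsto x cofinite (𝓝 0)) {s t : S} (hst : M s t = 0) {w : W}
    (hw : leftComm cs q s t x w ≠ 0) :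
    (cs.IsLeftDescent w s ∧ cs.IsRightDescent w t) ∨
      (cs.IsLeftDescent w t ∧ cs.IsRightDescent w s) := by
  have hs := hx.leftOp_leftComm_add hM s t
  have ht := hx.leftOp_leftComm_add hM t s
  rw [leftComm_swap, LinearMap.neg_apply, map_neg, map_neg, smul_neg, ← neg_add, neg_inj] at ht
  have h0' := tendsto_leftComm (cs := cs) (q := q) h0 s t
  have h1 := leftDescent_iff_not_rightDescent hM hs
    (fun v hv => eq_zero_of_isGrowing hM h0' hst hs ht hv) hw
  have h2 := leftDescent_iff_not_rightDescent hM ht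
    (fun v hv => eq_zero_of_isGrowing hM h0' (eq_zero_symm hst) ht hs hv) hw
  by_cases h : cs.IsLeftDescent w s
  · have h3 := not_isLeftDescent_of_isLeftDescent cs hM hst h
    exact Or.inl ⟨h, not_not.1 fun h4 => h3 (h2.2 h4)⟩
  · have h3 : cs.IsRightDescent w s := not_not.1 fun h4 => h (h1.2 h4)
    exact Or.inr ⟨h2.2 (not_isRightDescent_of_isRightDescent cs hM hst h3), h3⟩

/-- If `c` does not commute with `t`, then `c` is not a left descent on the support of the
commutator of `T_s` and `T_t`. This is clear unless `c` commutes with `s`, and then the commutator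
of `T_c` and `T_t` comes into play. -/
theorem IsCentral.not_isLeftDescent_of_leftComm_ne_zero {x : W → ℂ} (hx : IsCentral cs q x)
    (h0 : Tendsto x cofinite (𝓝 0)) {s t c : S} (hst : M s t = 0) (hct : M c t = 0) (hcs : c ≠ s)
    {w : W} (hw : leftComm cs q s t x w ≠ 0) : ¬ cs.IsLeftDescent w c := by
  intro hc
  have htc := eq_zero_symm hct
  rcases hx.support_leftComm hM h0 hst hw with ⟨hs, ht⟩ | ⟨ht, -⟩
  swap
  · exact not_isLeftDescent_of_isLeftDescent cs hM htc ht hc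
  have hsc : M s c = 2 := hM.eq_two hcs.symm fun h =>
    not_isLeftDescent_of_isLeftDescent cs hM h hs hc
  have hcs' : M c s = 2 := by rwa [M.symmetric]
  have hne : ∀ {a b : S}, a ≠ b → ∀ v : W, cs.simple a * v ≠ v * cs.simple b :=
    fun h v => simple_mul_ne_mul_simple cs hM h v
  -- evaluate the identity `[T_s, [T_c, T_t] x] = [T_c, [T_s, T_t] x]` at `v = c w`
  set v := cs.simple c * w with hv
  have hwv : cs.simple c * v = w := by rw [hv, cs.simple_mul_simple_cancel_left]
  have hvc : ¬ cs.IsLeftDescent v c := cs.isLeftDescent_iff_not_isLeftDescent_mul.1 hc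
  have hvs : cs.IsLeftDescent v s := (isLeftDescent_simple_mul_iff_of_comm cs hM hcs' w).2 hs
  have hvt : ¬ cs.IsLeftDescent v t := not_isLeftDescent_of_isLeftDescent cs hM hst hvs
  have hvt' : cs.IsRightDescent v t :=
    (isRightDescent_simple_mul_iff cs hM (hne (ne_of_eq_zero hct) w)).2 ht
  have hvc' := not_isRightDescent_of_isRightDescent cs hM htc hvt'
  have hvs' := not_isRightDescent_of_isRightDescent cs hM (eq_zero_symm hst) hvt'
  have key := congrFun (hx.leftOp_leftComm_sub hM t hsc) v
  rw [Pi.sub_apply, Pi.sub_apply, leftOp_of_descent q hvs, rightOp_of_not_descent q hvs',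
    leftOp_of_not_descent q hvc, rightOp_of_not_descent q hvc', hwv] at key
  have z1 : leftComm cs q c t x v = 0 := by
    by_contra h
    rcases hx.support_leftComm hM h0 hct h with h | h
    · exact hvc h.1
    · exact hvt h.1
  have z2 : leftComm cs q c t x (cs.simple s * v) = 0 := by
    by_contra h
    have h1 := (isRightDescent_simple_mul_iff cs hM (hne (ne_of_eq_zero hst) v)).2 hvt'
    rcases hx.support_leftComm hM h0 hct h with h | h
    · exact hvc ((isLeftDescent_simple_mul_iff_of_comm cs hM hsc v).1 h.1)
    · exact not_isRightDescent_of_isRightDescent cs hM hct h.2 h1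
  have z3 : leftComm cs q c t x (v * cs.simple s) = 0 := by
    by_contra h
    rcases hx.support_leftComm hM h0 hct h with h | h
    · exact hvc ((isLeftDescent_mul_simple_iff cs hM (hne hcs v)).1 h.1)
    · exact hvt ((isLeftDescent_mul_simple_iff cs hM
        (hne (ne_of_eq_zero (eq_zero_symm hst)) v)).1 h.1)
  have z4 : leftComm cs q s t x (v * cs.simple c) = 0 := by
    by_contra h
    have h1 : cs.IsRightDescent (v * cs.simple c) c := by
      rwa [cs.isRightDescent_iff_not_isRightDescent_mul, cs.simple_mul_simple_cancel_right]
    have h2 := (isLeftDescent_mul_simple_iff cs hM (hne hcs.symm v)).2 hvs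
    rcases hx.support_leftComm hM h0 hst h with h | h
    · exact not_isRightDescent_of_isRightDescent cs hM hct h1 h.2
    · exact not_isLeftDescent_of_isLeftDescent cs hM hst h2 h.1
  rw [z1, z2, z3, z4] at key
  exact hw (by linear_combination -key)

theorem IsCentral.not_isRightDescent_of_leftComm_ne_zero {x : W → ℂ} (hx : IsCentral cs q x)
    (h0 : Tendsto x cofinite (𝓝 0)) {s t c : S} (hst : M s t = 0) (hct : M c t = 0) (hcs : c ≠ s)
    {w : W} (hw : leftComm cs q s t x w ≠ 0) : ¬ cs.IsRightDescent w c := by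
  have h1 := (isCentral_compInv hx).leftComm_eq hM s t
  rw [rightComm_compInv, leftComm_swap cs q s t, LinearMap.neg_apply] at h1
  rw [← cs.isLeftDescent_inv_iff]
  refine (isCentral_compInv hx).not_isLeftDescent_of_leftComm_ne_zero hM (tendsto_compInv h0)
    hst hct hcs ?_
  rw [h1, compInv, inv_inv]
  simpa using hw

end Support

/-! ### Comparing commutators at infinity -/

section Compare

open Filter Topology

variable {S W : Type*} [Group W] {M : CoxeterMatrix S} {cs : CoxeterSystem M W} {q : S → ℝ}

theorem leftOp_apply_of_vanish {x : W → ℂ} {s : S} (hx : ∀ w, cs.IsLeftDescent w s → x w = 0)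
    (w : W) : leftOp cs q s x w = x (cs.simple s * w) := by
  by_cases h : cs.IsLeftDescent w s
  · rw [leftOp_of_descent q h, hx w h, mul_zero, add_zero]
  · rw [leftOp_of_not_descent q h]

theorem isLeftDescent_of_leftOp_ne_zero {x : W → ℂ} {s : S}
    (hx : ∀ w, cs.IsLeftDescent w s → x w = 0) {w : W} (hw : leftOp cs q s x w ≠ 0) :
    cs.IsLeftDescent w s := by
  by_contra h
  refine hw ?_
  rw [leftOp_of_not_descent q h]
  apply hx
  rwa [cs.isLeftDescent_iff_not_isLeftDescent_mul, cs.simple_mul_simple_cancel_left]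

variable (hM : IsRightAngled M)
include hM

/-- If `x` vanishes on the elements with left descent `c`, then the operators `T_v` along paths
starting at `c` only translate `x`. -/
theorem leftWord_of_vanish {x : W → ℂ} {c : S} (hx : ∀ w, cs.IsLeftDescent w c → x w = 0)
    {m : List S} {b : S} (hm : (b :: m).IsChain (fun s t => M s t = 0)) (hs : [c] <:+ b :: m) :
    (∀ w, leftWord cs q (b :: m) x w = x ((cs.wordProd (b :: m))⁻¹ * w)) ∧
      ∀ w, leftWord cs q (b :: m) x w ≠ 0 → cs.IsLeftDescent w b := by
  induction m generalizing b with
  | nil =>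
    obtain rfl : c = b := by simpa using hs.eq_of_length_le (by simp)
    have h : leftWord cs q [c] x = leftOp cs q c x := by simp [leftWord]
    rw [h]
    refine ⟨fun w => ?_, fun w hw => isLeftDescent_of_leftOp_ne_zero hx hw⟩
    rw [leftOp_apply_of_vanish hx, cs.wordProd_singleton, cs.inv_simple]
  | cons d m ih =>
    obtain ⟨hbd, hm⟩ := List.isChain_cons_cons.1 hm
    have hs' : [c] <:+ d :: m := by
      rcases List.suffix_cons_iff.1 hs with h | h
      · simp at h
      · exact h
    obtain ⟨h1, h2⟩ := ih hm hs'
    have hv : ∀ w, cs.IsLeftDescent w b → leftWord cs q (d :: m) x w = 0 := by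
      intro w hw
      by_contra h
      exact not_isLeftDescent_of_isLeftDescent cs hM hbd hw (h2 w h)
    rw [leftWord_cons, Module.End.mul_apply]
    refine ⟨fun w => ?_, fun w hw => isLeftDescent_of_leftOp_ne_zero hv hw⟩
    rw [leftOp_apply_of_vanish hv, h1, cs.wordProd_cons b, mul_inv_rev, cs.inv_simple, mul_assoc]

theorem leftOp_leftOp_of_vanish {x : W → ℂ} {s t : S} (hst : M s t = 0)
    (ht : ∀ w, cs.IsLeftDescent w t → x w = 0) :
    (∀ w, leftOp cs q s (leftOp cs q t x) w = x (cs.simple t * (cs.simple s * w))) ∧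
      ∀ w, leftOp cs q s (leftOp cs q t x) w ≠ 0 → cs.IsLeftDescent w s := by
  have hv : ∀ w, cs.IsLeftDescent w s → leftOp cs q t x w = 0 := by
    intro w hw
    by_contra h
    exact not_isLeftDescent_of_isLeftDescent cs hM hst hw (isLeftDescent_of_leftOp_ne_zero ht h)
  refine ⟨fun w => ?_, fun w hw => isLeftDescent_of_leftOp_ne_zero hv hw⟩
  rw [leftOp_apply_of_vanish hv, leftOp_apply_of_vanish ht]

/-- Along a path ending with `t`, `c`, where `c ≠ s` is a neighbour of `t`, the functions
`T_v x` of `leftWord_of_vanish` vanish on the elements with left descent `s` or `t`. -/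
theorem leftWord_vanish {x : W → ℂ} {s t c d : S} (hst : M s t = 0) (hct : M c t = 0) (hcs : c ≠ s)
    (hx : ∀ w, cs.IsLeftDescent w d → x w = 0) {m : List S}
    (hm : (c :: t :: m).IsChain (fun s t => M s t = 0)) (hs : [d] <:+ t :: m) (w : W)
    (hw : cs.IsLeftDescent w s ∨ cs.IsLeftDescent w t) : leftWord cs q (c :: t :: m) x w = 0 := by
  by_contra h
  obtain ⟨h1, h2⟩ := leftWord_of_vanish (q := q) hM hx hm (hs.trans (List.suffix_cons c _))
  obtain ⟨h3, h4⟩ := leftWord_of_vanish (q := q) hM hx (List.isChain_cons_cons.1 hm).2 hs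
  have hc := h2 w h
  rcases hw with hw | hw
  · have hsc : M c s = 2 := hM.eq_two hcs fun h0 =>
      not_isLeftDescent_of_isLeftDescent cs hM h0 hc hw
    rw [h1, cs.wordProd_cons c, mul_inv_rev, cs.inv_simple, mul_assoc, ← h3] at h
    exact not_isLeftDescent_of_isLeftDescent cs hM hst
      ((isLeftDescent_simple_mul_iff_of_comm cs hM hsc w).2 hw) (h4 _ h)
  · exact not_isLeftDescent_of_isLeftDescent cs hM hct hc hw

/-- On `T_v x` as in `leftWord_vanish`, the commutator of `T_s` and `T_t` is a difference of
translations. -/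
theorem leftComm_leftWord_apply {x : W → ℂ} {s t c d : S} (hst : M s t = 0) (hct : M c t = 0)
    (hcs : c ≠ s) (hx : ∀ w, cs.IsLeftDescent w d → x w = 0) {m : List S}
    (hm : (c :: t :: m).IsChain (fun s t => M s t = 0)) (hs : [d] <:+ t :: m) (w : W) :
    leftComm cs q s t (leftWord cs q (c :: t :: m) x) w =
      x ((cs.wordProd (c :: t :: m))⁻¹ * (cs.simple t * (cs.simple s * w))) -
        x ((cs.wordProd (c :: t :: m))⁻¹ * (cs.simple s * (cs.simple t * w))) := by
  have hv := leftWord_vanish (q := q) hM hst hct hcs hx hm hs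
  have h1 := (leftWord_of_vanish (q := q) hM hx hm (hs.trans (List.suffix_cons c _))).1
  rw [leftComm, LinearMap.sub_apply, Module.End.mul_apply, Module.End.mul_apply, Pi.sub_apply,
    (leftOp_leftOp_of_vanish hM hst fun w hw => hv w (Or.inr hw)).1,
    (leftOp_leftOp_of_vanish hM (eq_zero_symm hst) fun w hw => hv w (Or.inl hw)).1, h1, h1]

/-- At `s t v w` only one of the two translations contributes. -/
theorem leftComm_leftWord_apply_mul {x : W → ℂ} {s t c d : S} (hst : M s t = 0) (hct : M c t = 0)
    (hcs : c ≠ s) (hx : ∀ w, cs.IsLeftDescent w d → x w = 0) {m : List S}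
    (hm : (c :: t :: m).IsChain (fun s t => M s t = 0)) (hs : [d] <:+ t :: m) {w : W}
    (hw : ¬ cs.IsLeftDescent w d) :
    leftComm cs q s t (leftWord cs q (c :: t :: m) x)
      (cs.simple s * (cs.simple t * (cs.wordProd (c :: t :: m) * w))) = x w := by
  classical
  set v := cs.wordProd (c :: t :: m) with hv
  -- the translations are supported on the elements with left descent `s` and `t`, respectively;
  -- the characteristic function of `w` shows that `s` is a left descent of `s t v w`
  have hdesc : cs.IsLeftDescent (cs.simple s * (cs.simple t * (v * w))) s := by
    have hδ : ∀ u, cs.IsLeftDescent u d → (Pi.single w 1 : W → ℂ) u = 0 := by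
      intro u hu
      rw [Pi.single_apply, if_neg]
      rintro rfl
      exact hw hu
    have h1 := leftWord_vanish (q := q) hM hst hct hcs hδ hm hs
    have h2 := (leftWord_of_vanish (q := q) hM hδ hm (hs.trans (List.suffix_cons c _))).1
    obtain ⟨h3, h4⟩ := leftOp_leftOp_of_vanish (q := q) hM hst fun w hw => h1 w (Or.inr hw)
    refine h4 _ ?_
    rw [h3, h2, ← hv]
    simp
  have hdesc' := not_isLeftDescent_of_isLeftDescent cs hM hst hdesc
  have h1 := leftWord_vanish (q := q) hM hst hct hcs hx hm hs
  have h2 := (leftWord_of_vanish (q := q) hM hx hm (hs.trans (List.suffix_cons c _))).1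
  obtain ⟨h3, h4⟩ := leftOp_leftOp_of_vanish (q := q) hM (eq_zero_symm hst)
    fun w hw => h1 w (Or.inl hw)
  have h5 : x (v⁻¹ * (cs.simple s * (cs.simple t *
      (cs.simple s * (cs.simple t * (v * w)))))) = 0 := by
    by_contra h
    refine hdesc' (h4 _ ?_)
    rwa [h3, h2]
  rw [leftComm_leftWord_apply hM hst hct hcs hx hm hs, ← hv, h5]
  simp

/-- For a central function `x`, the values of the commutator of `T_{s'}` and `T_{t'}` are
differences of values of the commutator of `T_s` and `T_t` at `s t g` and `s t g'`, where `g` and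
`g'` run through conjugates of `w t' s'` and `w s' t'`. -/
theorem IsCentral.leftComm_apply_eq {x : W → ℂ} (hx : IsCentral cs q x)
    (h0 : Tendsto x cofinite (𝓝 0)) {s t c s' t' c' : S}
    (hst : M s t = 0) (hct : M c t = 0) (hcs : c ≠ s)
    (hst' : M s' t' = 0) (hct' : M c' t' = 0) (hcs' : c' ≠ s') {m : List S}
    (hm : (c :: t :: m).IsChain (fun s t => M s t = 0)) (hs : [t', c'] <:+ t :: m) {w : W}
    (hw : ¬ cs.IsLeftDescent w c') :
    leftComm cs q s' t' x w =
      leftComm cs q s t x (cs.simple s * cs.simple t *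
        conjWord cs (c :: t :: m) (w * (cs.simple t' * cs.simple s'))) -
      leftComm cs q s t x (cs.simple s * cs.simple t *
        conjWord cs (c :: t :: m) (w * (cs.simple s' * cs.simple t'))) := by
  have hv' : ∀ w, cs.IsLeftDescent w c' → leftComm cs q s' t' x w = 0 := by
    intro w hw
    by_contra h
    exact hx.not_isLeftDescent_of_leftComm_ne_zero hM h0 hst' hct' hcs' h hw
  have hv : ∀ w, cs.IsLeftDescent w c → compInv (leftComm cs q s t x) w = 0 := by
    intro w hw
    by_contra h
    exact hx.not_isRightDescent_of_leftComm_ne_zero hM h0 hst hct hcs h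
      (cs.isRightDescent_inv_iff.2 hw)
  obtain ⟨n, hn⟩ := hs
  have hrev : (c :: t :: m).reverse = c' :: t' :: (n.reverse ++ [c]) := by
    rw [← hn]
    simp
  have hm' : (c' :: t' :: (n.reverse ++ [c])).IsChain (fun s t => M s t = 0) := by
    rw [← hrev, List.isChain_reverse]
    exact hm.imp fun a b h => eq_zero_symm h
  have key := congrFun (hx.leftComm_leftWord_leftComm hM s t s' t' (c :: t :: m))
    (cs.simple s * (cs.simple t * (cs.wordProd (c :: t :: m) * w)))
  rw [leftComm_leftWord_apply_mul hM hst hct hcs hv' hm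
    ((List.suffix_cons t' [c']).trans ⟨n, hn⟩) hw] at key
  rw [key, ← compInv_compInv (leftComm cs q s t x), rightWord_compInv, rightComm_compInv, hrev,
    compInv, leftComm_swap, LinearMap.neg_apply, Pi.neg_apply,
    leftComm_leftWord_apply hM hst' hct' hcs' hv hm'
      ((List.suffix_append n.reverse [c]).trans (List.suffix_cons t' _)), neg_sub, compInv_compInv,
    ← hrev, cs.wordProd_reverse]
  simp only [compInv, conjWord, mul_inv_rev, inv_inv, cs.inv_simple, mul_assoc]

/-- Finitely many non-trivial elements can be made to grow simultaneously. -/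
theorem exists_isGrown_list [Finite S] (hirr : IsIrreducible M) (hS : 3 ≤ Nat.card S)
    (gs : List W) (hg : ∀ g ∈ gs, g ≠ 1) {a : S} {m : List S}
    (hm : (a :: m).IsChain (fun s t => M s t = 0)) :
    ∃ b m', (b :: m').IsChain (fun s t => M s t = 0) ∧ a :: m <:+ b :: m' ∧
      ∀ g ∈ gs, IsGrown cs b (conjWord cs (b :: m') g) := by
  induction gs with
  | nil => exact ⟨a, m, hm, List.suffix_rfl, by simp⟩
  | cons g gs ih =>
    obtain ⟨b, m1, h1, h2, h3⟩ := ih fun g' hg' => hg g' (List.mem_cons_of_mem _ hg')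
    obtain ⟨b', m2, h4, h5, h6⟩ := exists_isGrown cs hM hirr hS (hg g List.mem_cons_self) h1
    refine ⟨b', m2, h4, h2.trans h5, fun g' hg' => ?_⟩
    rcases List.mem_cons.1 hg' with rfl | hg'
    · exact h6
    · exact (h3 g' hg').extend hM h4 h5

/-- Finitely many non-trivial elements have conjugates of large length by the same element, which
may be taken to be the product of a path with given ends. -/
theorem exists_long_conj [Finite S] (hirr : IsIrreducible M) (hS : 3 ≤ Nat.card S)
    (gs : List W) (hg : ∀ g ∈ gs, g ≠ 1) {t c t' c' : S} (hct : M c t = 0) (hct' : M c' t' = 0)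
    (N : ℕ) : ∃ m, (c :: t :: m).IsChain (fun s t => M s t = 0) ∧ [t', c'] <:+ t :: m ∧
      ∀ g ∈ gs, N ≤ cs.length (conjWord cs (c :: t :: m) g) := by
  have htc := eq_zero_symm hct
  suffices ∃ m, (t :: m).IsChain (fun s t => M s t = 0) ∧ [t', c'] <:+ t :: m ∧
      ∀ g ∈ gs, IsGrown cs t (conjWord cs (t :: m) g) ∧
        N ≤ cs.length (conjWord cs (t :: m) g) by
    obtain ⟨m, h1, h2, h3⟩ := this
    refine ⟨m, List.isChain_cons_cons.2 ⟨hct, h1⟩, h2, fun g hg => ?_⟩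
    obtain ⟨h4, h5⟩ := h3 g hg
    rw [conjWord_cons, (h4.isGrowing hM hct).length_eq hM]
    omega
  induction N with
  | zero =>
    have hm : [t', c'].IsChain (fun s t => M s t = 0) :=
      List.isChain_cons_cons.2 ⟨eq_zero_symm hct', List.isChain_singleton _⟩
    obtain ⟨b, m1, h1, h2, h3⟩ := exists_isGrown_list (cs := cs) hM hirr hS gs hg hm
    obtain ⟨m2, h4, h5⟩ := exists_chain_extension hM hirr h1 t
    exact ⟨m2, h4, h2.trans h5, fun g hg => ⟨(h3 g hg).extend hM h4 h5, Nat.zero_le _⟩⟩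
  | succ N ih =>
    obtain ⟨m, h1, h2, h3⟩ := ih
    have h4 : (t :: c :: t :: m).IsChain (fun s t => M s t = 0) :=
      List.isChain_cons_cons.2 ⟨htc, List.isChain_cons_cons.2 ⟨hct, h1⟩⟩
    have hsuf : t :: m <:+ t :: c :: t :: m :=
      (List.suffix_cons c _).trans (List.suffix_cons t _)
    refine ⟨c :: t :: m, h4, h2.trans hsuf, fun g hg => ?_⟩
    obtain ⟨h5, h6⟩ := h3 g hg
    refine ⟨h5.extend hM h4 hsuf, ?_⟩
    have h7 := h5.isGrowing hM hct
    rw [conjWord_cons, conjWord_cons, ((h7.isGrown hM).isGrowing hM htc).length_eq hM,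
      h7.length_eq hM]
    omega

theorem not_isLeftDescent_simple_mul_simple {s t c : S} (hcs : c ≠ s) (hct : c ≠ t) :
    ¬ cs.IsLeftDescent (cs.simple s * cs.simple t) c := by
  rw [isLeftDescent_mul_simple_iff cs hM (simple_mul_ne_mul_simple cs hM hct _),
    ← one_mul (cs.simple s), isLeftDescent_mul_simple_iff cs hM
    (simple_mul_ne_mul_simple cs hM hcs 1)]
  exact cs.not_isLeftDescent_one c

open Classical in
/-- For a central function vanishing at infinity, the commutators of the `T_s` act as they do on a
multiple of `δ_e`. -/
theorem IsCentral.leftComm_apply [Finite S] (hirr : IsIrreducible M) (hS : 3 ≤ Nat.card S)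
    {x : W → ℂ} (hx : IsCentral cs q x) (h0 : Tendsto x cofinite (𝓝 0)) {s t c s' t' c' : S}
    (hst : M s t = 0) (hct : M c t = 0) (hcs : c ≠ s)
    (hst' : M s' t' = 0) (hct' : M c' t' = 0) (hcs' : c' ≠ s') (w : W) :
    leftComm cs q s' t' x w = leftComm cs q s t x (cs.simple s * cs.simple t) *
      ((if w = cs.simple s' * cs.simple t' then 1 else 0) -
        if w = cs.simple t' * cs.simple s' then 1 else 0) := by
  have hct_ne := ne_of_eq_zero hct'
  by_cases hw : cs.IsLeftDescent w c'
  · have h1 : leftComm cs q s' t' x w = 0 := by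
      by_contra h
      exact hx.not_isLeftDescent_of_leftComm_ne_zero hM h0 hst' hct' hcs' h hw
    rw [h1, if_neg, if_neg, sub_zero, mul_zero]
    · rintro rfl
      exact not_isLeftDescent_simple_mul_simple hM hct_ne hcs' hw
    · rintro rfl
      exact not_isLeftDescent_simple_mul_simple hM hcs' hct_ne hw
  set y := leftComm cs q s t x with hy
  have hy0 : Tendsto y cofinite (𝓝 0) := tendsto_leftComm h0 s t
  set g₁ := w * (cs.simple t' * cs.simple s') with hg₁
  set g₂ := w * (cs.simple s' * cs.simple t') with hg₂
  have e₁ : w = cs.simple s' * cs.simple t' ↔ g₁ = 1 := by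
    rw [hg₁, mul_eq_one_iff_eq_inv, mul_inv_rev, cs.inv_simple, cs.inv_simple]
  have e₂ : w = cs.simple t' * cs.simple s' ↔ g₂ = 1 := by
    rw [hg₂, mul_eq_one_iff_eq_inv, mul_inv_rev, cs.inv_simple, cs.inv_simple]
  simp only [e₁, e₂]
  refine eq_of_forall_dist_le fun ε hε => ?_
  obtain ⟨N, hN⟩ := exists_length_bound cs hy0 (half_pos hε)
  obtain ⟨m, hm, hsuf, hlong⟩ := exists_long_conj (cs := cs) hM hirr hS
    ([g₁, g₂].filter (· ≠ 1)) (by simp) hct hct' (N + 2)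
  have hterm : ∀ g ∈ [g₁, g₂], ‖y (cs.simple s * cs.simple t * conjWord cs (c :: t :: m) g) -
      y (cs.simple s * cs.simple t) * (if g = 1 then 1 else 0)‖ ≤ ε / 2 := by
    intro g hg
    by_cases h : g = 1
    · subst h
      simp [conjWord, (half_pos hε).le]
    · rw [if_neg h, mul_zero, sub_zero]
      refine (hN _ ?_).le
      have h1 := hlong g (List.mem_filter.2 ⟨hg, by simpa using h⟩)
      have h2 := cs.length_le_length_mul_add_left (cs.simple s * cs.simple t)
        (conjWord cs (c :: t :: m) g)
      have h3 := cs.length_mul_le (cs.simple s) (cs.simple t)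
      rw [cs.length_simple, cs.length_simple] at h3
      omega
  rw [hx.leftComm_apply_eq hM h0 hst hct hcs hst' hct' hcs' hm hsuf hw, ← hy, ← hg₁, ← hg₂,
    dist_eq_norm]
  have h1 := hterm g₁ (by simp)
  have h2 := hterm g₂ (by simp)
  calc _ = ‖(y (cs.simple s * cs.simple t * conjWord cs (c :: t :: m) g₁) -
        y (cs.simple s * cs.simple t) * (if g₁ = 1 then 1 else 0)) -
      (y (cs.simple s * cs.simple t * conjWord cs (c :: t :: m) g₂) -
        y (cs.simple s * cs.simple t) * (if g₂ = 1 then 1 else 0))‖ := by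
        congr 1
        ring
    _ ≤ ε := (norm_sub_le _ _).trans (by linarith)

end Compare

/-! ### Vectors on which all Hecke operators commute -/

section Decomposition

open Filter Topology

variable {S W : Type*} [Group W] {M : CoxeterMatrix S} {cs : CoxeterSystem M W} {q : S → ℝ}
  {r : ℝ≥0∞}

theorem coe_heckeLeft (s : S) (η : Ell W r) : ⇑(heckeLeft cs q s η) = leftOp cs q s η := rfl

/-- The operators `T_s` commute on the cyclic submodule generated by `η`. -/
def IsCommuting (cs : CoxeterSystem M W) (q : S → ℝ) (η : Ell W r) : Prop :=
  ∀ (l : List S) (s t : S), leftComm cs q s t (leftWord cs q l η) = 0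

theorem IsCommuting.add {η₁ η₂ : Ell W r} (h₁ : IsCommuting cs q η₁) (h₂ : IsCommuting cs q η₂) :
    IsCommuting cs q (η₁ + η₂) := by
  intro l s t
  rw [lp.coeFn_add, map_add, map_add, h₁, h₂, add_zero]

theorem IsCommuting.smul {η : Ell W r} (h : IsCommuting cs q η) (c : ℂ) :
    IsCommuting cs q (c • η) := by
  intro l s t
  rw [lp.coeFn_smul, map_smul, map_smul, h, smul_zero]

theorem IsCommuting.heckeLeft {η : Ell W r} (h : IsCommuting cs q η) (s : S) :
    IsCommuting cs q (heckeLeft cs q s η) := by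
  intro l a b
  have h1 := h (l ++ [s]) a b
  rw [leftWord, List.map_append, List.prod_append] at h1
  rw [coe_heckeLeft]
  simpa [leftWord] using h1

theorem IsCommuting.heckeLeft_comm {η : Ell W r} (h : IsCommuting cs q η) (s t : S) :
    RACoxeter.heckeLeft cs q s (RACoxeter.heckeLeft cs q t η) =
      RACoxeter.heckeLeft cs q t (RACoxeter.heckeLeft cs q s η) := by
  have h1 := h [] s t
  refine lp.ext ?_
  rw [← sub_eq_zero]
  exact h1

theorem heckeLeft_heckeLeft (s : S) (η : Ell W r) :
    heckeLeft cs q s (heckeLeft cs q s η) = η + (pCoeff q s : ℂ) • heckeLeft cs q s η := by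
  refine lp.ext ?_
  exact congrArg (· (η : W → ℂ)) (leftOp_mul_self cs q s)

/-- The eigenvalue `ε_s √(q_s^{ε_s})` of `T_s` on `η_ε`. -/
def eigenvalue (q : S → ℝ) (s : S) (ε : ℤˣ) : ℝ := signedSqrt (((ε : ℤ) : ℝ) * q s ^ (ε : ℤ))

theorem eigenvalue_one {s : S} (hq : 0 < q s) : eigenvalue q s 1 = √(q s) := by
  simp [eigenvalue, signedSqrt, hq, abs_of_pos hq]

theorem eigenvalue_neg_one {s : S} (hq : 0 < q s) : eigenvalue q s (-1) = -(√(q s))⁻¹ := by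
  have h : -(q s)⁻¹ < 0 := neg_neg_of_pos (inv_pos.2 hq)
  simp [eigenvalue, signedSqrt, abs_of_pos hq, sign_neg, hq]

theorem signedSqrt_mul (x y : ℝ) : signedSqrt (x * y) = signedSqrt x * signedSqrt y := by
  rw [signedSqrt, signedSqrt, signedSqrt, sign_mul, abs_mul, Real.sqrt_mul (abs_nonneg x)]
  push_cast
  ring

theorem signedSqrt_one : signedSqrt 1 = 1 := by
  simp [signedSqrt]

/-- A joint eigenvector is determined by its value at `1`, and proportional to `η_ε`. -/
theorem apply_wordProd_of_eigenvector {η : Ell W r} {ε : S → ℤˣ}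
    (h : ∀ s, heckeLeft cs q s η = (eigenvalue q s (ε s) : ℂ) • η) {ω : List S}
    (hω : cs.IsReduced ω) : η (cs.wordProd ω) = η 1 * signedSqrt (wordWeight q ε ω) := by
  induction ω with
  | nil => simp [wordWeight, signedSqrt_one]
  | cons s ω ih =>
    have hω' : cs.IsReduced ω := hω.drop 1
    have hdesc : ¬ cs.IsLeftDescent (cs.wordProd ω) s := by
      rw [cs.not_isLeftDescent_iff, ← cs.wordProd_cons, hω.eq, hω'.eq, List.length_cons]
    have h1 := congrArg (fun ζ : Ell W r => ζ (cs.wordProd ω)) (h s)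
    simp only [coe_heckeLeft, leftOp_of_not_descent q hdesc, lp.coeFn_smul, Pi.smul_apply,
      smul_eq_mul] at h1
    have h2 : wordWeight q ε (s :: ω) = ((ε s : ℤ) : ℝ) * q s ^ (ε s : ℤ) * wordWeight q ε ω := by
      simp [wordWeight]
    rw [cs.wordProd_cons, h1, ih hω', h2, signedSqrt_mul]
    push_cast [eigenvalue]
    ring

variable (cs q r) in
/-- The set of the eigenvectors `η_ε` that belong to `ℓ^r(W)`. -/
def etaSet : Set (Ell W r) :=
  {η | IsHeckeEigenvector cs q η ∧ ∃ ε : S → ℤˣ, IsEta cs q ε η}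

theorem mem_span_of_eigenvector {η : Ell W r} {ε : S → ℤˣ}
    (h : ∀ s, heckeLeft cs q s η = (eigenvalue q s (ε s) : ℂ) • η) :
    η ∈ Submodule.span ℂ (etaSet cs q r) := by
  by_cases h0 : η 1 = 0
  · have : η = 0 := by
      refine lp.ext (funext fun w => ?_)
      obtain ⟨ω, hω, rfl⟩ := cs.exists_isReduced w
      rw [apply_wordProd_of_eigenvector h hω, h0, zero_mul, lp.coeFn_zero, Pi.zero_apply]
    rw [this]
    exact Submodule.zero_mem _
  · have h1 : η = η 1 • ((η 1)⁻¹ • η) := by rw [smul_smul, mul_inv_cancel₀ h0, one_smul]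
    rw [h1]
    refine Submodule.smul_mem _ _ (Submodule.subset_span ⟨⟨?_, fun s => ?_⟩, ε, fun ω hω => ?_⟩)
    · refine smul_ne_zero (inv_ne_zero h0) ?_
      rintro rfl
      exact h0 rfl
    · exact ⟨eigenvalue q s (ε s), by rw [map_smul, h s, smul_comm]⟩
    · rw [lp.coeFn_smul, Pi.smul_apply, smul_eq_mul, apply_wordProd_of_eigenvector h hω,
        inv_mul_cancel_left₀ h0]

/-- If the operators `T_s` commute on the cyclic module generated by `η`, then `η` is a sum of joint
eigenvectors, obtained by applying the spectral projections of the `T_s`. -/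
theorem IsCommuting.mem_span [Finite S] (hq : ∀ s, 0 < q s) {η : Ell W r}
    (hη : IsCommuting cs q η) : η ∈ Submodule.span ℂ (etaSet cs q r) := by
  classical
  have := Fintype.ofFinite S
  suffices ∀ (A : Finset S) (η : Ell W r), IsCommuting cs q η →
      (∀ s ∉ A, ∃ ε : ℤˣ, RACoxeter.heckeLeft cs q s η = (eigenvalue q s ε : ℂ) • η) →
      η ∈ Submodule.span ℂ (etaSet cs q r) from
    this Finset.univ η hη fun s hs => absurd (Finset.mem_univ s) hs
  intro A
  induction A using Finset.induction_on with
  | empty =>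
    intro η _ h
    choose ε hε using fun s => h s (Finset.notMem_empty s)
    exact mem_span_of_eigenvector hε
  | insert a A ha ih =>
    intro η hη h
    set T := RACoxeter.heckeLeft (r := r) cs q a with hT
    have hsq : 0 < √(q a) := Real.sqrt_pos.2 (hq a)
    set x : ℂ := ((√(q a) : ℝ) : ℂ) with hx
    have hx0 : x ≠ 0 := Complex.ofReal_ne_zero.2 hsq.ne'
    have hsum : x + x⁻¹ ≠ 0 := by
      rw [hx, ← Complex.ofReal_inv, ← Complex.ofReal_add, Complex.ofReal_ne_zero]
      positivity
    have hp : (pCoeff q a : ℂ) = x - x⁻¹ := by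
      rw [hx, ← Complex.ofReal_inv, ← Complex.ofReal_sub, pCoeff]
      congr 1
      field_simp
      rw [Real.sq_sqrt (hq a).le]
    have hTT : T (T η) = η + (x - x⁻¹) • T η := by
      rw [hT, heckeLeft_heckeLeft, hp]
    -- a multiple of the spectral projection onto the eigenspace for the other eigenvalue
    have hproj : ∀ (y : ℂ) (ε : ℤˣ), (∀ ζ : Ell W r, T (T η) + y • T η = ζ →
          ζ = (eigenvalue q a ε : ℂ) • (T η + y • η)) →
        T η + y • η ∈ Submodule.span ℂ (etaSet cs q r) := by
      intro y ε hy
      refine ih _ ((hη.heckeLeft a).add (hη.smul y)) fun s hs => ?_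
      by_cases hsa : s = a
      · subst hsa
        exact ⟨ε, by rw [map_add, map_smul]; exact hy _ rfl⟩
      · obtain ⟨ε', hε'⟩ := h s (by simp [hsa, hs])
        refine ⟨ε', ?_⟩
        rw [map_add, map_smul, hT, hη.heckeLeft_comm s a, hε', map_smul, smul_add, smul_comm y]
    have h1 : T η + x⁻¹ • η ∈ Submodule.span ℂ (etaSet cs q r) := by
      refine hproj _ 1 ?_
      rintro ζ rfl
      rw [eigenvalue_one (hq a), hTT, ← hx, smul_add, smul_smul, mul_inv_cancel₀ hx0]
      module
    have h2 : T η + (-x) • η ∈ Submodule.span ℂ (etaSet cs q r) := by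
      refine hproj _ (-1) ?_
      rintro ζ rfl
      rw [eigenvalue_neg_one (hq a), hTT, Complex.ofReal_neg, Complex.ofReal_inv, ← hx, smul_add,
        smul_smul, neg_mul_neg, inv_mul_cancel₀ hx0]
      module
    have h3 : η = (x + x⁻¹)⁻¹ • ((T η + x⁻¹ • η) - (T η + (-x) • η)) := by
      have : (T η + x⁻¹ • η) - (T η + (-x) • η) = (x + x⁻¹) • η := by module
      rw [this, smul_smul, inv_mul_cancel₀ hsum, one_smul]
    rw [h3]
    exact Submodule.smul_mem _ _ (Submodule.sub_mem _ h1 h2)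

theorem tendsto_of_memℓp {α : Type*} (hr : 1 ≤ r) (hr' : r ≠ ∞) (ξ : Ell α r) :
    Tendsto (ξ : α → ℂ) cofinite (𝓝 0) := by
  have hpos : 0 < r.toReal := ENNReal.toReal_pos (zero_lt_one.trans_le hr).ne' hr'
  have h1 := ((memℓp_gen_iff hpos).1 (lp.memℓp ξ)).tendsto_cofinite_zero
  have h2 := h1.rpow_const (p := r.toReal⁻¹) (Or.inr (inv_nonneg.2 hpos.le))
  rw [Real.zero_rpow (inv_ne_zero hpos.ne')] at h2
  refine tendsto_zero_iff_norm_tendsto_zero.2 (h2.congr fun w => ?_)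
  rw [← Real.rpow_mul (norm_nonneg _), mul_inv_cancel₀ hpos.ne', Real.rpow_one]

theorem IsHeckeCentral.isCentral {ξ : Ell W r} (hξ : IsHeckeCentral cs q ξ) :
    IsCentral cs q (ξ : W → ℂ) := by
  intro s
  have h := hξ [s] (by simp [CoxeterSystem.IsReduced])
  exact congrArg (fun ζ : Ell W r => (ζ : W → ℂ)) h

theorem delta_apply_eq_zero_of_isLeftDescent (s : S) (w : W) (hw : cs.IsLeftDescent w s) :
    delta r (1 : W) w = 0 := by
  refine delta_of_ne r ?_
  rintro rfl
  exact cs.not_isLeftDescent_one s hw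

theorem isCentral_delta : IsCentral cs q (delta r (1 : W) : W → ℂ) := by
  intro s
  have h : compInv (delta r (1 : W) : W → ℂ) = delta r (1 : W) := by
    funext w
    by_cases hw : w = 1
    · simp [compInv, hw]
    · rw [compInv, delta_of_ne r hw, delta_of_ne r (inv_ne_one.2 hw)]
  funext w
  rw [← h, rightOp_compInv, compInv, h,
    leftOp_apply_of_vanish (delta_apply_eq_zero_of_isLeftDescent s),
    leftOp_apply_of_vanish (delta_apply_eq_zero_of_isLeftDescent s), ← congrFun h, compInv]
  by_cases hw : w = cs.simple s
  · simp [hw]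
  · rw [delta_of_ne r, delta_of_ne r]
    · simpa [mul_eq_one_iff_eq_inv, inv_eq_iff_eq_inv, eq_comm] using hw
    · rw [Ne, inv_eq_one, mul_eq_one_iff_inv_eq, cs.inv_simple]
      exact fun h => hw h.symm

open Classical in
theorem leftComm_delta (hM : IsRightAngled M) {s t : S} (hst : M s t = 0) (w : W) :
    leftComm cs q s t (delta r (1 : W)) w = (if w = cs.simple s * cs.simple t then 1 else 0) -
        if w = cs.simple t * cs.simple s then 1 else 0 := by
  have key : ∀ a b : S, delta r (1 : W) (cs.simple b * (cs.simple a * w)) =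
      if w = cs.simple a * cs.simple b then 1 else 0 := by
    intro a b
    split_ifs with h
    · rw [h]
      simp [delta_self]
    · refine delta_of_ne r fun h' => h ?_
      rw [← mul_assoc, mul_eq_one_iff_inv_eq] at h'
      simp [← h']
  rw [leftComm, LinearMap.sub_apply, Module.End.mul_apply, Module.End.mul_apply, Pi.sub_apply,
    (leftOp_leftOp_of_vanish hM hst (delta_apply_eq_zero_of_isLeftDescent t)).1,
    (leftOp_leftOp_of_vanish hM (eq_zero_symm hst) (delta_apply_eq_zero_of_isLeftDescent s)).1,
    key, key]

/-- A Hecke central vector differs from a vector on which all `T_s` commute by a multiple of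
`δ_e`. -/
theorem IsHeckeCentral.exists_isCommuting [Finite S] (hM : IsRightAngled M)
    (hirr : IsIrreducible M) (hS : 3 ≤ Nat.card S) (hr : 1 ≤ r) (hr' : r ≠ ∞) {ξ : Ell W r}
    (hξ : IsHeckeCentral cs q ξ) : ∃ C : ℂ, IsCommuting cs q (ξ - C • delta r 1) := by
  classical
  have hx := hξ.isCentral
  have h0 := tendsto_of_memℓp hr hr' ξ
  obtain ⟨t₀, s₀, c₀, hne, hs₀, hc₀⟩ := exists_two_neighbours hM hirr hS
  set C := leftComm cs q s₀ t₀ ξ (cs.simple s₀ * cs.simple t₀) with hC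
  refine ⟨C, ?_⟩
  have hpair : ∀ s t c, M s t = 0 → M c t = 0 → c ≠ s →
      leftComm cs q s t ↑(ξ - C • delta r 1 : Ell W r) = 0 := by
    intro s t c hst hct hcs
    funext w
    rw [lp.coeFn_sub, lp.coeFn_smul, map_sub, map_smul, Pi.sub_apply, Pi.smul_apply, smul_eq_mul,
      leftComm_delta hM hst,
      hx.leftComm_apply hM hirr hS h0 hs₀ hc₀ hne.symm hst hct hcs w, Pi.zero_apply, ← hC, sub_self]
  have hall : ∀ s t, leftComm cs q s t ↑(ξ - C • delta r 1 : Ell W r) = 0 := by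
    intro s t
    by_cases hst : s = t
    · rw [hst, leftComm, sub_self, LinearMap.zero_apply]
    · rcases hM s t hst with h | h
      · rw [leftComm, (leftOp_comm_leftOp cs q hM h).eq, sub_self, LinearMap.zero_apply]
      · obtain ⟨c, hcs, hct, hc | hc⟩ := exists_adjacent_edge hM hirr hS s t
        · exact hpair s t c h hc hcs
        · rw [leftComm_swap, LinearMap.neg_apply, hpair t s c (eq_zero_symm h) hc hct, neg_zero]
  have hcent : IsCentral cs q ↑(ξ - C • delta r 1 : Ell W r) := by
    intro s
    rw [lp.coeFn_sub, lp.coeFn_smul, map_sub, map_sub, map_smul, map_smul, hx s, isCentral_delta s]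
  intro l s t
  have h1 := congrArg (· (↑(ξ - C • delta r 1 : Ell W r) : W → ℂ))
    (leftComm_comm_rightWord (cs := cs) (q := q) hM s t l).eq
  simp only [Module.End.mul_apply] at h1
  rw [hcent.leftWord_eq hM, h1, hall, map_zero]

end Decomposition
end RACoxeter

end

theorem mainTheorem2 {S W : Type*} [Finite S] [Group W] {M : CoxeterMatrix S}
    (cs : CoxeterSystem M W) (hM : RACoxeter.IsRightAngled M) (hirr : RACoxeter.IsIrreducible M)
    (hS : 3 ≤ Nat.card S) (q : S → ℝ) (hq : ∀ s, q s ∈ Set.Ioc (0 : ℝ) 1)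
    (r : ℝ≥0∞) (hr : 1 ≤ r) (hr' : r ≠ ∞)
    (ξ : RACoxeter.Ell W r) (hξ : RACoxeter.IsHeckeCentral cs q ξ) :
    ξ ∈ Submodule.span ℂ
      ({η : RACoxeter.Ell W r | RACoxeter.IsHeckeEigenvector cs q η ∧
          ∃ ε : S → ℤˣ, RACoxeter.IsEta cs q ε η} ∪ {RACoxeter.delta r 1}) := by
  obtain ⟨C, hC⟩ := hξ.exists_isCommuting hM hirr hS hr hr'
  have h1 := Submodule.span_mono (Set.subset_union_left (t := {RACoxeter.delta r 1}))
    (hC.mem_span fun s => (hq s).1)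
  have h2 := Submodule.smul_mem _ C (Submodule.subset_span (R := ℂ)
    (Set.mem_union_right (RACoxeter.etaSet cs q r) (Set.mem_singleton (RACoxeter.delta r 1))))
  have h3 := Submodule.add_mem _ h1 h2
  rwa [sub_add_cancel] at h3
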